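/- Let $1<R_2<R_1<R$, write $D_R=\{z\in\mathbb C:|z|<R\}$, $\mathbb T=\mathbb R/\mathbb Z$ with Lebesgue measure $|\cdot|$ of total mass one, and $e(x)=\exp(2\pi i x)$. Put $$B_0=\frac{1}{2\log(R/R_1)}\cdot\frac{R_1+R_2}{R_1-R_2}\cdot\begin{cases}\log R,& R^2-R_1^2>R,\\ \log\frac{R^2}{R^2-R_1^2},& R^2-R_1^2\le R,\end{cases}\qquad B_1=B_0\,\frac{8R_2}{R_2^2-1},$$ $$B_2=B_0\,\frac{16\pi(R_2^2-1)\sqrt{16R_2^2-\big(\sqrt{R_2^4+34R_2^2+1}-1-R_2^2\big)^2}}{\big(3R_2^2+3-\sqrt{R_2^4+34R_2^2+1}\big)^2},\qquad B_3=\sqrt{5B_2+\frac{10\pi}{\log(R/R_1)}}.$$ Let $v:D_R\to\mathbb R\cup\{-\infty\}$ be subharmonic (upper semicontinuous with the sub-mean value property), with $v\le B$ on $D_R$ and $v(0)=m\in\mathbb R$. Suppose that for some $c\in\mathbb R$ $$v(e(x))=v_1(x)+v_0(x)+c\quad\text{for a.e. }x\in\mathbb T,\qquad \|v_1\|_{L^1(\mathbb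 T)}<\varepsilon_1,\quad \|v_0\|_{L^\infty(\mathbb T)}<\varepsilon_0,$$ with $v_1,v_0$ real-valued and measurable, and that $\varepsilon_1\le \frac{B_3^2}{289}(B-m)$. Set $\delta_0=\frac92\varepsilon_0+2B_3\sqrt{\varepsilon_1(B-m)}$. Then $$\int_{\mathbb T}\exp\Big(\frac{\pi}{4}\,\delta_0^{-1}\,|v(e(x))-c|\Big)\,dx\;\le\; C_0:=2\sqrt2\,\exp\Big(\pi\Big[\frac{17}{144}+\frac{B_1}{16B_3^2}\Big]\Big),$$ and for every $\varepsilon_2>0$ $$\big|\{x\in\mathbb T:\ |v(e(x))-c|>\varepsilon_2\}\big|\;\le\;2\sqrt2\,\exp\Big(\frac{\pi}{4}\Big[\frac{17}{144}+\frac{B_1}{16B_3^2}-\varepsilon_2\,\delta_0^{-1}\Big]\Big).$$ -/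

import Mathlib

open MeasureTheory

noncomputable section

/-- `e(x) = exp(2πix)`, as a map from the circle `ℝ/ℤ` to `ℂ`. The measure `volume` on
`UnitAddCircle` is the Lebesgue measure, of total mass one. -/
def expCircle (x : UnitAddCircle) : ℂ := (AddCircle.toCircle x : ℂ)

/-- The integral over the circle `ℝ/ℤ` of a function with values in `[-∞, ∞]`, as the integral of
the positive part minus that of the negative part. For a function that is bounded above, it is the
usual integral with values in `[-∞, ∞)`. -/
def circleMean (f : UnitAddCircle → EReal) : EReal :=
  ((∫⁻ x, (f x).toENNReal : ENNReal) : EReal) - ((∫⁻ x, (-f x).toENNReal : ENNReal) : EReal)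

/-- Subharmonic functions on `Ω ⊆ ℂ`: upper semicontinuous, with values in `ℝ ∪ {-∞}`, and with
the sub-mean value property on every closed disk contained in `Ω`. -/
structure IsSubharmonicOn (v : ℂ → EReal) (Ω : Set ℂ) : Prop where
  ne_top : ∀ z ∈ Ω, v z ≠ ⊤
  upperSemicontinuousOn : UpperSemicontinuousOn v Ω
  le_circleMean : ∀ (z : ℂ) (r : ℝ), 0 < r → Metric.closedBall z r ⊆ Ω →
    v z ≤ circleMean (fun θ => v (z + r * expCircle θ))

/-- The constant `B₀(R, R₁, R₂)`. If `R² - R₁² = R`, both cases give the same value. -/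
def constB0 (R R₁ R₂ : ℝ) : ℝ :=
  1 / (2 * Real.log (R / R₁)) * ((R₁ + R₂) / (R₁ - R₂)) *
    (if R ^ 2 - R₁ ^ 2 > R then Real.log R else Real.log (R ^ 2 / (R ^ 2 - R₁ ^ 2)))

/-- The constant `B₁(R, R₁, R₂)`. -/
def constB1 (R R₁ R₂ : ℝ) : ℝ :=
  constB0 R R₁ R₂ * (8 * R₂ / (R₂ ^ 2 - 1))

/-- The constant `B₂(R, R₁, R₂)`. -/
def constB2 (R R₁ R₂ : ℝ) : ℝ :=
  constB0 R R₁ R₂ *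
    (16 * Real.pi * (R₂ ^ 2 - 1) *
        √(16 * R₂ ^ 2 - (√(R₂ ^ 4 + 34 * R₂ ^ 2 + 1) - 1 - R₂ ^ 2) ^ 2) /
      (3 * R₂ ^ 2 + 3 - √(R₂ ^ 4 + 34 * R₂ ^ 2 + 1)) ^ 2)

/-- The constant `B₃(R, R₁, R₂)`. -/
def constB3 (R R₁ R₂ : ℝ) : ℝ :=
  √(5 * constB2 R R₁ R₂ + 10 * Real.pi / Real.log (R / R₁))

/-- `δ₀ = (9/2) ε₀ + 2 B₃ √(ε₁ (B - m))`. -/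
def delta0 (R R₁ R₂ B m ε₀ ε₁ : ℝ) : ℝ :=
  9 / 2 * ε₀ + 2 * constB3 R R₁ R₂ * √(ε₁ * (B - m))

/-- `C₀ = 2√2 exp(π [17/144 + B₁ / (16 B₃²)])`. -/
def constC0 (R R₁ R₂ : ℝ) : ℝ :=
  2 * √2 *
    Real.exp (Real.pi * (17 / 144 + constB1 R R₁ R₂ / (16 * constB3 R R₁ R₂ ^ 2)))

end

/-!
The function `w = B - v` is nonnegative and superharmonic. Averaging its rotations against a
Poisson kernel keeps it so and makes its values on the unit circle the real part of a function `Q`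
holomorphic across the circle. By the minimum principle `w` dominates `Re Q` inside the circle and,
in an annulus outside, the reflection of `Re Q` corrected by a multiple of `log ‖z‖`. Were
`Re (z * Q' z)` too negative at a point of the circle, these two minorants would meet there in a
convex kink, contradicting the mean value inequality for `w`. Hence, with the sign of `Q` changed
so that `Re Q` is the boundary value of `v - c`, the conjugate function `Im Q` is a multiple
`κ * t` of the angle minus a monotone function of it. A monotone function deviates from its
averages over arcs of half-width `δ` by at most its increments over length `δ`, and these are
controlled by a Poisson integral at distance `π * δ` from the circle, that is, by `ε₀`, `ε₁ / δ` and
`κ * δ`; the choice `κ * δ ^ 2 = ε₁` balances the last two. Finally, if `P` is holomorphic with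
`P 0 = 0` and `|Im P|` is small on the circle, then the mean value property of `cosh ∘ (a * P)`
bounds the integral of `cosh (a * Re P)`. Letting the Poisson kernel concentrate gives the theorem.
-/

namespace SubharmonicSplitting

open Filter InnerProductSpace Metric Real Set Topology
open scoped ComplexConjugate ENNReal

section Circle

instance isProbabilityMeasure_volume_unitAddCircle :
    IsProbabilityMeasure (volume : Measure UnitAddCircle) :=
  ⟨UnitAddCircle.measure_univ⟩

@[simp]
lemma norm_expCircle (x : UnitAddCircle) : ‖expCircle x‖ = 1 :=
  Circle.norm_coe _

lemma expCircle_ne_zero (x : UnitAddCircle) : expCircle x ≠ 0 :=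
  Circle.coe_ne_zero _

@[fun_prop]
lemma continuous_expCircle : Continuous expCircle :=
  continuous_subtype_val.comp AddCircle.continuous_toCircle

lemma expCircle_add (x y : UnitAddCircle) : expCircle (x + y) = expCircle x * expCircle y := by
  simp [expCircle, AddCircle.toCircle_add]

@[simp]
lemma expCircle_zero : expCircle 0 = 1 := by
  simp [expCircle]

lemma expCircle_neg (x : UnitAddCircle) : expCircle (-x) = (expCircle x)⁻¹ := by
  simp [expCircle, AddCircle.toCircle_neg]

lemma expCircle_sub (x y : UnitAddCircle) : expCircle (x - y) = expCircle x / expCircle y := by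
  rw [sub_eq_add_neg, expCircle_add, expCircle_neg, div_eq_mul_inv]

lemma expCircle_coe (t : ℝ) :
    expCircle (t : UnitAddCircle) = Complex.exp (2 * π * t * Complex.I) := by
  simp [expCircle, AddCircle.toCircle_apply_mk, Circle.coe_exp]

lemma exists_expCircle_eq {z : ℂ} (hz : ‖z‖ = 1) : ∃ x, expCircle x = z := by
  obtain ⟨x, hx⟩ := (AddCircle.homeomorphCircle (T := 1) one_ne_zero).surjective
    ⟨z, mem_sphere_zero_iff_norm.2 hz⟩
  rw [AddCircle.homeomorphCircle_apply] at hx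
  exact ⟨x, by rw [expCircle, hx]⟩

lemma add_mul_expCircle_mem_closedBall (z : ℂ) {r : ℝ} (hr : 0 ≤ r) (θ : UnitAddCircle) :
    z + r * expCircle θ ∈ closedBall z r := by
  simp [mem_closedBall, dist_eq_norm, abs_of_nonneg hr]

lemma continuous_comp_add_mul_expCircle {X : Type*} [TopologicalSpace X] {U : ℂ → X} {z : ℂ}
    {r : ℝ} (hr : 0 ≤ r) (hU : ContinuousOn U (closedBall z r)) :
    Continuous fun θ => U (z + r * expCircle θ) :=
  hU.comp_continuous (by fun_prop) (add_mul_expCircle_mem_closedBall z hr)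

lemma circleMap_eq_add_mul_expCircle (c : ℂ) (r θ : ℝ) :
    circleMap c r θ = c + r * expCircle ((θ / (2 * π) : ℝ) : UnitAddCircle) := by
  rw [expCircle_coe, circleMap]
  congr 3
  push_cast
  field_simp

lemma circleIntegrable_of_integrable_comp_expCircle {F : Type*} [NormedAddCommGroup F]
    {f : ℂ → F} (hf : Integrable fun x => f (expCircle x)) : CircleIntegrable f 0 1 := by
  have hIoc : IntegrableOn (fun x : ℝ => f (expCircle (x : UnitAddCircle))) (Ioc 0 (0 + 1)) :=
    (UnitAddCircle.measurePreserving_mk 0).integrable_comp_of_integrable hf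
  have hinterval :
      IntervalIntegrable (fun x : ℝ => f (expCircle (x : UnitAddCircle))) volume 0 1 := by
    rw [intervalIntegrable_iff_integrableOn_Ioc_of_le zero_le_one]
    simpa using hIoc
  have hscale := hinterval.comp_mul_right (c := (2 * π)⁻¹)
  rw [CircleIntegrable]
  simpa [circleMap_eq_add_mul_expCircle, div_eq_mul_inv] using hscale

variable {F : Type*} [NormedAddCommGroup F] [NormedSpace ℝ F]

lemma integral_add_mul_expCircle (f : ℂ → F) (c : ℂ) (r : ℝ) :
    ∫ x, f (c + r * expCircle x) = circleAverage f c r := by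
  have hscale := intervalIntegral.inv_smul_integral_comp_div (a := 0) (b := 2 * π)
    (fun x : ℝ => f (c + r * expCircle (x : UnitAddCircle))) (2 * π)
  rw [zero_div, div_self (by positivity)] at hscale
  rw [← UnitAddCircle.intervalIntegral_preimage 0 fun x => f (c + r * expCircle x), zero_add,
    ← hscale, circleAverage_def]
  simp only [circleMap_eq_add_mul_expCircle]

lemma integral_comp_expCircle (f : ℂ → F) : ∫ x, f (expCircle x) = circleAverage f 0 1 := by
  simpa using integral_add_mul_expCircle f 0 1

lemma integral_add_mul_expCircle_of_harmonicOnNhd {U : ℂ → ℝ} {z : ℂ} {r : ℝ} (hr : 0 ≤ r)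
    (hU : HarmonicOnNhd U (closedBall z r)) : ∫ θ, U (z + r * expCircle θ) = U z := by
  rw [integral_add_mul_expCircle,
    InnerProductSpace.HarmonicOnNhd.circleAverage_eq (by rwa [abs_of_nonneg hr])]

end Circle

section Measure

lemma integrable_of_continuous {X E : Type*} [TopologicalSpace X] [CompactSpace X]
    [MeasurableSpace X] [OpensMeasurableSpace X] {μ : Measure X} [IsFiniteMeasureOnCompacts μ]
    [NormedAddCommGroup E] {f : X → E} (hf : Continuous f) : Integrable f μ :=
  hf.integrable_of_hasCompactSupport (.of_compactSpace f)

lemma ofReal_integral_le_lintegral_ofReal {X : Type*} [MeasurableSpace X] {μ : Measure X}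
    {f : X → ℝ} (hf : Integrable f μ) :
    ENNReal.ofReal (∫ x, f x ∂μ) ≤ ∫⁻ x, ENNReal.ofReal (f x) ∂μ := by
  have hpos := ofReal_integral_eq_lintegral_ofReal hf.pos_part
    (Eventually.of_forall fun x => le_max_right _ _)
  simp only [ENNReal.ofReal_max, ENNReal.ofReal_zero, max_zero] at hpos
  rw [← hpos]
  exact ENNReal.ofReal_le_ofReal (integral_mono hf hf.pos_part fun x => le_max_left _ _)

lemma eq_of_lintegral_le_of_lowerSemicontinuous {X : Type*} [TopologicalSpace X]
    [MeasurableSpace X] [OpensMeasurableSpace X] {μ : Measure X} [IsProbabilityMeasure μ]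
    [μ.IsOpenPosMeasure] {f : X → ℝ≥0∞} (hf : LowerSemicontinuous f) {a : ℝ≥0∞} (ha : a ≠ ⊤)
    (hle : ∀ x, a ≤ f x) (hint : ∫⁻ x, f x ∂μ ≤ a) (x : X) : f x = a := by
  have hae : (fun _ => a) =ᵐ[μ] f :=
    ae_eq_of_ae_le_of_lintegral_le (.of_forall hle) (by simpa) hf.measurable.aemeasurable
      (by simpa)
  by_contra hne
  have hopen : IsOpen {y | a < f y} := hf.isOpen_preimage a
  exact (hopen.measure_pos μ ⟨x, (hle x).lt_of_ne' hne⟩).ne'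
    (measure_mono_null (fun y hy => ne_of_lt hy) hae)

end Measure

/-- A superharmonic function on `Ω` with values in `[0, ∞]`; the values outside `Ω` are
irrelevant. -/
structure IsNonnegSuperharmonicOn (w : ℂ → ℝ≥0∞) (Ω : Set ℂ) : Prop where
  lowerSemicontinuousOn : LowerSemicontinuousOn w Ω
  lintegral_le : ∀ (z : ℂ) (r : ℝ), 0 < r → closedBall z r ⊆ Ω →
    ∫⁻ θ, w (z + r * expCircle θ) ≤ w z

section Gap

/-- The gap `B - v` below the upper bound `B` of a subharmonic function `v`, as a function with
values in `[0, ∞]`. -/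
noncomputable def superharmonicGap (v : ℂ → EReal) (B : ℝ) (z : ℂ) : ℝ≥0∞ :=
  ((B : EReal) - v z).toENNReal

lemma continuous_coe_sub_toENNReal (B : ℝ) :
    Continuous fun t : EReal => ((B : EReal) - t).toENNReal := by
  refine EReal.continuous_toENNReal.comp (continuous_iff_continuousAt.2 fun t => ?_)
  have hadd : ContinuousAt (fun p : EReal × EReal => p.1 + p.2) ((B : EReal), -t) :=
    EReal.continuousAt_add (.inl (EReal.coe_ne_top _)) (.inl (EReal.coe_ne_bot _))
  exact hadd.comp (f := fun t : EReal => ((B : EReal), -t))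
    (continuous_const.prodMk continuous_neg).continuousAt

lemma antitone_coe_sub_toENNReal (B : ℝ) :
    Antitone fun t : EReal => ((B : EReal) - t).toENNReal := fun _ _ h =>
  EReal.toENNReal_le_toENNReal (EReal.sub_le_sub le_rfl h)

lemma toENNReal_add_toENNReal_neg {B : ℝ} {t : EReal} (ht : t ≤ B) :
    (B : EReal).toENNReal + (-t).toENNReal =
      (-(B : EReal)).toENNReal + t.toENNReal + ((B : EReal) - t).toENNReal := by
  induction t with
  | bot => simp
  | top => simp at ht
  | coe t =>
    have htB : t ≤ B := by exact_mod_cast ht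
    rw [← EReal.coe_neg, ← EReal.coe_neg, ← EReal.coe_sub]
    simp only [EReal.toENNReal_of_ne_top (EReal.coe_ne_top _), EReal.toReal_coe]
    rw [← ENNReal.toReal_eq_toReal_iff' (by finiteness) (by finiteness)]
    repeat rw [ENNReal.toReal_add (by finiteness) (by finiteness)]
    simp only [ENNReal.toReal_ofReal']
    grind

lemma circleMean_eq_coe_sub_lintegral {f : UnitAddCircle → EReal} (hf : Measurable f) {B : ℝ}
    (hB : ∀ x, f x ≤ B) :
    circleMean f = B - ((∫⁻ x, ((B : EReal) - f x).toENNReal : ℝ≥0∞) : EReal) := by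
  have hsum : (B : EReal).toENNReal + ∫⁻ x, (-f x).toENNReal =
      (-(B : EReal)).toENNReal + (∫⁻ x, (f x).toENNReal) +
        ∫⁻ x, ((B : EReal) - f x).toENNReal := by
    have h := lintegral_congr (μ := (volume : Measure UnitAddCircle)) fun x =>
      toENNReal_add_toENNReal_neg (hB x)
    rw [lintegral_add_left measurable_const,
      lintegral_add_left (f := fun x => (-(B : EReal)).toENNReal + (f x).toENNReal)
        (measurable_const.add hf.ereal_toENNReal),
      lintegral_add_left measurable_const] at h
    simpa using h
  have hfin : ∫⁻ x, (f x).toENNReal ≠ ⊤ :=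
    ne_top_of_le_ne_top (b := (B : EReal).toENNReal) (by simp) <|
      (lintegral_mono fun x => EReal.toENNReal_le_toENNReal (hB x)).trans (by simp)
  rw [circleMean]
  generalize (∫⁻ x, (f x).toENNReal) = a at *
  generalize (∫⁻ x, (-f x).toENNReal) = b at *
  generalize (∫⁻ x, ((B : EReal) - f x).toENNReal) = J at *
  lift a to NNReal using hfin
  rcases eq_or_ne b ⊤ with rfl | hb
  · have hJ : J = ⊤ := by simpa [ENNReal.add_eq_top] using hsum.symm
    simp [hJ]
  have hJ : J ≠ ⊤ := by
    rintro rfl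
    simp [ENNReal.add_eq_top, hb] at hsum
  lift b to NNReal using hb
  lift J to NNReal using hJ
  have hreal : max B 0 + b = max (-B) 0 + a + J := by
    simpa [← EReal.coe_neg, EReal.toENNReal_of_ne_top, ENNReal.toReal_add, ENNReal.toReal_ofReal']
      using congrArg ENNReal.toReal hsum
  have hsub : (a : ℝ) - b = B - J := by grind
  exact congrArg Real.toEReal hsub

lemma isNonnegSuperharmonicOn_superharmonicGap {v : ℂ → EReal} {Ω : Set ℂ}
    (hv : IsSubharmonicOn v Ω) {B : ℝ} (hB : ∀ z ∈ Ω, v z ≤ (B : EReal)) :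
    IsNonnegSuperharmonicOn (superharmonicGap v B) Ω where
  lowerSemicontinuousOn :=
    (continuous_coe_sub_toENNReal B).comp_upperSemicontinuousOn_antitone hv.upperSemicontinuousOn
      (antitone_coe_sub_toENNReal B)
  lintegral_le z r hr hsub := by
    have hmem (θ) : z + r * expCircle θ ∈ Ω := hsub (add_mul_expCircle_mem_closedBall z hr.le θ)
    have husc : UpperSemicontinuous fun θ => v (z + r * expCircle θ) :=
      upperSemicontinuousOn_univ_iff.1 <| hv.upperSemicontinuousOn.comp
        (g := fun θ => z + r * expCircle θ) (by fun_prop) fun θ _ => hmem θ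
    have hmean := hv.le_circleMean z r hr hsub
    rw [circleMean_eq_coe_sub_lintegral husc.measurable fun θ => hB _ (hmem θ),
      EReal.le_sub_iff_add_le (by simp) (by simp), add_comm,
      ← EReal.le_sub_iff_add_le (by simp) (by simp)] at hmean
    simpa [superharmonicGap] using EReal.toENNReal_le_toENNReal hmean

end Gap

namespace IsNonnegSuperharmonicOn

variable {w w₁ w₂ : ℂ → ℝ≥0∞} {Ω Ω' : Set ℂ}

lemma mono (hw : IsNonnegSuperharmonicOn w Ω) (h : Ω' ⊆ Ω) : IsNonnegSuperharmonicOn w Ω' where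
  lowerSemicontinuousOn := hw.lowerSemicontinuousOn.mono h
  lintegral_le z r hr hsub := hw.lintegral_le z r hr (hsub.trans h)

lemma lowerSemicontinuous_comp (hw : IsNonnegSuperharmonicOn w Ω) {X : Type*} [TopologicalSpace X]
    {g : X → ℂ} (hg : Continuous g) (hgΩ : ∀ x, g x ∈ Ω) :
    LowerSemicontinuous fun x => w (g x) :=
  lowerSemicontinuousOn_univ_iff.1 <|
    hw.lowerSemicontinuousOn.comp hg.continuousOn fun x _ => hgΩ x

lemma lowerSemicontinuous_circle (hw : IsNonnegSuperharmonicOn w Ω) {z : ℂ} {r : ℝ} (hr : 0 ≤ r)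
    (hsub : closedBall z r ⊆ Ω) : LowerSemicontinuous fun θ => w (z + r * expCircle θ) :=
  hw.lowerSemicontinuous_comp (by fun_prop) fun θ =>
    hsub (add_mul_expCircle_mem_closedBall z hr θ)

lemma add (hw₁ : IsNonnegSuperharmonicOn w₁ Ω) (hw₂ : IsNonnegSuperharmonicOn w₂ Ω) :
    IsNonnegSuperharmonicOn (fun z => w₁ z + w₂ z) Ω where
  lowerSemicontinuousOn := hw₁.lowerSemicontinuousOn.add hw₂.lowerSemicontinuousOn
  lintegral_le z r hr hsub := by
    rw [lintegral_add_left (hw₁.lowerSemicontinuous_circle hr.le hsub).measurable]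
    exact add_le_add (hw₁.lintegral_le z r hr hsub) (hw₂.lintegral_le z r hr hsub)

end IsNonnegSuperharmonicOn

lemma isNonnegSuperharmonicOn_ofReal {U : ℂ → ℝ} {Ω : Set ℂ} (hU : HarmonicOnNhd U Ω)
    (hpos : ∀ z ∈ Ω, 0 ≤ U z) : IsNonnegSuperharmonicOn (fun z => ENNReal.ofReal (U z)) Ω where
  lowerSemicontinuousOn :=
    (ENNReal.continuous_ofReal.comp_continuousOn fun z hz =>
      (hU z hz).1.continuousAt.continuousWithinAt).lowerSemicontinuousOn
  lintegral_le z r hr hsub := by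
    have hcont : Continuous fun θ => U (z + r * expCircle θ) :=
      continuous_comp_add_mul_expCircle hr.le fun x hx =>
        (hU x (hsub hx)).1.continuousAt.continuousWithinAt
    rw [← ofReal_integral_eq_lintegral_ofReal (integrable_of_continuous hcont)
        (.of_forall fun θ => hpos _ (hsub (add_mul_expCircle_mem_closedBall z hr.le θ))),
      integral_add_mul_expCircle_of_harmonicOnNhd hr.le (hU.mono hsub)]

section RotationAverage

variable {w : ℂ → ℝ≥0∞} {p : UnitAddCircle → ℝ≥0∞} {R : ℝ}

/-- The average of the rotations of `w` with respect to the density `p`; it regularizes the values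
of `w` on circles around the origin. -/
noncomputable def rotationAverage (w : ℂ → ℝ≥0∞) (p : UnitAddCircle → ℝ≥0∞) (z : ℂ) : ℝ≥0∞ :=
  ∫⁻ y, w (z * expCircle y) * p y

lemma mul_expCircle_mem_ball {z : ℂ} (hz : z ∈ ball (0 : ℂ) R) (x : UnitAddCircle) :
    z * expCircle x ∈ ball (0 : ℂ) R := by
  simpa using hz

lemma closedBall_mul_expCircle_subset_ball {z : ℂ} {r : ℝ} (h : closedBall z r ⊆ ball (0 : ℂ) R)
    (y : UnitAddCircle) : closedBall (z * expCircle y) r ⊆ ball (0 : ℂ) R := by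
  intro x hx
  have hrot : x / expCircle y ∈ closedBall z r := by
    rw [mem_closedBall, dist_eq_norm] at hx ⊢
    rwa [← mul_div_cancel_right₀ z (expCircle_ne_zero y), ← sub_div, norm_div, norm_expCircle,
      div_one]
  simpa [expCircle_ne_zero] using mul_expCircle_mem_ball (h hrot) y

lemma lintegral_add_mul_expCircle_mul_expCircle (f : ℂ → ℝ≥0∞) (z : ℂ) (r : ℝ)
    (y : UnitAddCircle) :
    ∫⁻ θ, f ((z + r * expCircle θ) * expCircle y) =
      ∫⁻ θ, f (z * expCircle y + r * expCircle θ) := by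
  rw [← lintegral_add_right_eq_self (fun θ => f (z * expCircle y + r * expCircle θ)) y]
  simp only [expCircle_add, add_mul, mul_assoc]

-- Fatou's lemma along a sequence.
lemma lowerSemicontinuousOn_rotationAverage (hw : IsNonnegSuperharmonicOn w (ball 0 R))
    (hp : Measurable p) : LowerSemicontinuousOn (rotationAverage w p) (ball 0 R) := by
  intro z hz a ha
  by_contra hfreq
  rw [not_eventually] at hfreq
  obtain ⟨u, hu, hu'⟩ :=
    exists_seq_forall_of_frequently (hfreq.and_eventually self_mem_nhdsWithin)
  have hmeas (n) : Measurable fun y => w (u n * expCircle y) * p y :=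
    (hw.lowerSemicontinuous_comp (by fun_prop) (mul_expCircle_mem_ball (hu' n).2)).measurable.mul hp
  have hpoint (y) : w (z * expCircle y) * p y ≤
      liminf (fun n => w (u n * expCircle y) * p y) atTop := by
    have hlim : Tendsto (fun n => u n * expCircle y) atTop (𝓝[ball 0 R] (z * expCircle y)) :=
      tendsto_nhdsWithin_iff.2 ⟨(tendsto_nhds_of_tendsto_nhdsWithin hu).mul_const _,
        .of_forall fun n => mul_expCircle_mem_ball (hu' n).2 y⟩
    calc w (z * expCircle y) * p y
        ≤ liminf (fun n => w (u n * expCircle y)) atTop * liminf (fun _ : ℕ => p y) atTop := by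
          gcongr
          · exact (lowerSemicontinuousWithinAt_iff_le_liminf.1
              (hw.lowerSemicontinuousOn _ (mul_expCircle_mem_ball hz y))).trans
              hlim.liminf_le_liminf_comp
          · simp
      _ ≤ _ := ENNReal.le_liminf_mul
  have hle : rotationAverage w p z ≤ a := calc
    rotationAverage w p z ≤ liminf (fun n => rotationAverage w p (u n)) atTop :=
      (lintegral_mono hpoint).trans (lintegral_liminf_le hmeas)
    _ ≤ a := liminf_le_of_frequently_le' (.of_forall fun n => not_lt.1 (hu' n).1)
  exact hle.not_gt ha

lemma isNonnegSuperharmonicOn_rotationAverage (hw : IsNonnegSuperharmonicOn w (ball 0 R))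
    (hp : Measurable p) : IsNonnegSuperharmonicOn (rotationAverage w p) (ball 0 R) where
  lowerSemicontinuousOn := lowerSemicontinuousOn_rotationAverage hw hp
  lintegral_le z r hr hsub := by
    have hmem (θ y) : (z + r * expCircle θ) * expCircle y ∈ ball (0 : ℂ) R :=
      mul_expCircle_mem_ball (hsub (add_mul_expCircle_mem_closedBall z hr.le θ)) y
    have hmeas₂ : Measurable fun q : UnitAddCircle × UnitAddCircle =>
        w ((z + r * expCircle q.1) * expCircle q.2) :=
      (hw.lowerSemicontinuous_comp (g := fun q : UnitAddCircle × UnitAddCircle =>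
        (z + r * expCircle q.1) * expCircle q.2) (by fun_prop) fun q => hmem q.1 q.2).measurable
    have hmeas (y) : Measurable fun θ => w ((z + r * expCircle θ) * expCircle y) :=
      (hw.lowerSemicontinuous_comp (by fun_prop) fun θ => hmem θ y).measurable
    calc ∫⁻ θ, ∫⁻ y, w ((z + r * expCircle θ) * expCircle y) * p y
        = ∫⁻ y, ∫⁻ θ, w ((z + r * expCircle θ) * expCircle y) * p y :=
          lintegral_lintegral_swap (hmeas₂.mul (hp.comp measurable_snd)).aemeasurable
      _ = ∫⁻ y, (∫⁻ θ, w (z * expCircle y + r * expCircle θ)) * p y := by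
          refine lintegral_congr fun y => ?_
          rw [lintegral_mul_const _ (hmeas y), lintegral_add_mul_expCircle_mul_expCircle]
      _ ≤ ∫⁻ y, w (z * expCircle y) * p y := by
          gcongr with y
          exact hw.lintegral_le _ r hr (closedBall_mul_expCircle_subset_ball hsub y)

end RotationAverage

namespace IsNonnegSuperharmonicOn

variable {w : ℂ → ℝ≥0∞} {D Ω K : Set ℂ} {U V : ℂ → ℝ}

-- At the rightmost point of the set of minimizers a circle of minimizers would reach further right.
lemma le_of_le_on_diff (hw : IsNonnegSuperharmonicOn w Ω) (hΩ : IsOpen Ω) (hK : IsCompact K)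
    (hΩK : Ω ⊆ K) (hlsc : LowerSemicontinuousOn w K) {a : ℝ≥0∞} (hbd : ∀ z ∈ K \ Ω, a ≤ w z)
    {z : ℂ} (hz : z ∈ K) : a ≤ w z := by
  obtain ⟨z₀, hz₀, hmin⟩ := hlsc.exists_isMinOn ⟨z, hz⟩ hK
  refine le_trans ?_ (hmin hz)
  by_contra! hlt
  obtain ⟨z₁, ⟨hz₁K, hz₁ : w z₁ ≤ w z₀⟩, hmax⟩ :=
    (hlsc.isCompact_inter_preimage_Iic hK (w z₀)).exists_isMaxOn ⟨z₀, hz₀, le_refl (w z₀)⟩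
      Complex.continuous_re.continuousOn
  have hz₁Ω : z₁ ∈ Ω := by
    by_contra h
    exact ((hbd z₁ ⟨hz₁K, h⟩).trans hz₁).not_gt hlt
  obtain ⟨r, hr, hrΩ⟩ := nhds_basis_closedBall.mem_iff.1 (hΩ.mem_nhds hz₁Ω)
  have hmem (θ) : z₁ + r * expCircle θ ∈ K :=
    hΩK (hrΩ (add_mul_expCircle_mem_closedBall z₁ hr.le θ))
  have hconst := eq_of_lintegral_le_of_lowerSemicontinuous
    (hw.lowerSemicontinuous_circle hr.le hrΩ) hlt.ne_top (fun θ => hmin (hmem θ))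
    ((hw.lintegral_le z₁ r hr hrΩ).trans hz₁) 0
  have hre := hmax ⟨hmem 0, hconst.le⟩
  simp only [expCircle_zero, mul_one, mem_ofPred_eq, Complex.add_re, Complex.ofReal_re] at hre
  linarith

lemma ofReal_le_of_le_on_diff (hw : IsNonnegSuperharmonicOn w D) (hK : IsCompact K)
    (hΩ : IsOpen Ω) (hΩK : Ω ⊆ K) (hKD : K ⊆ D) (hU : ContinuousOn U K)
    (hUΩ : HarmonicOnNhd U Ω) (hbd : ∀ z ∈ K \ Ω, ENNReal.ofReal (U z) ≤ w z) {z : ℂ}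
    (hz : z ∈ K) : ENNReal.ofReal (U z) ≤ w z := by
  obtain ⟨M, hM⟩ := hK.bddAbove_image hU
  replace hM (x) (hx : x ∈ K) : 0 ≤ M - U x := sub_nonneg.2 (hM (mem_image_of_mem U hx))
  have hharm : HarmonicOnNhd (fun x => M - U x) Ω := fun x hx =>
    HarmonicAt.sub (harmonicAt_const M) (hUΩ x hx)
  have hsum : IsNonnegSuperharmonicOn (fun x => w x + ENNReal.ofReal (M - U x)) Ω :=
    (hw.mono (hΩK.trans hKD)).add
      (isNonnegSuperharmonicOn_ofReal hharm fun x hx => hM x (hΩK hx))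
  have hlsc : LowerSemicontinuousOn (fun x => w x + ENNReal.ofReal (M - U x)) K :=
    (hw.lowerSemicontinuousOn.mono hKD).add
      (ENNReal.continuous_ofReal.comp_continuousOn
        (continuousOn_const.sub hU)).lowerSemicontinuousOn
  have hMle : ENNReal.ofReal M ≤ w z + ENNReal.ofReal (M - U z) := by
    refine hsum.le_of_le_on_diff hΩ hK hΩK hlsc (fun x hx => ?_) hz
    calc ENNReal.ofReal M = ENNReal.ofReal (U x + (M - U x)) := by rw [add_sub_cancel]
      _ ≤ ENNReal.ofReal (U x) + ENNReal.ofReal (M - U x) := ENNReal.ofReal_add_le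
      _ ≤ w x + ENNReal.ofReal (M - U x) := by gcongr; exact hbd x hx
  rcases le_total (U z) 0 with hneg | hpos
  · simp [ENNReal.ofReal_of_nonpos hneg]
  · rw [← add_sub_cancel (U z) M, ENNReal.ofReal_add hpos (hM z hz), add_sub_cancel] at hMle
    exact (ENNReal.add_le_add_iff_right ENNReal.ofReal_ne_top).1 hMle

lemma le_on_circle_of_touching (hw : IsNonnegSuperharmonicOn w D) {z₀ : ℂ} {r : ℝ} (hr : 0 < r)
    (hrD : closedBall z₀ r ⊆ D) (hU : HarmonicOnNhd U (closedBall z₀ r))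
    (hV : ContinuousOn V (closedBall z₀ r))
    (hle : ∀ z ∈ closedBall z₀ r, ENNReal.ofReal (max (U z) (V z)) ≤ w z)
    (hw₀ : w z₀ = ENNReal.ofReal (U z₀)) (hU₀ : 0 ≤ U z₀) (θ : UnitAddCircle) :
    V (z₀ + r * expCircle θ) ≤ U (z₀ + r * expCircle θ) := by
  by_contra! hlt
  have hUc : Continuous fun θ => U (z₀ + r * expCircle θ) :=
    continuous_comp_add_mul_expCircle hr.le fun z hz =>
      (hU z hz).1.continuousAt.continuousWithinAt
  have hmaxc : Continuous fun θ => max (U (z₀ + r * expCircle θ)) (V (z₀ + r * expCircle θ)) :=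
    hUc.max (continuous_comp_add_mul_expCircle hr.le hV)
  have hstrict : U z₀ < ∫ θ, max (U (z₀ + r * expCircle θ)) (V (z₀ + r * expCircle θ)) := by
    rw [← integral_add_mul_expCircle_of_harmonicOnNhd hr.le hU, ← sub_pos,
      ← integral_sub (integrable_of_continuous hmaxc) (integrable_of_continuous hUc)]
    refine (hmaxc.sub hUc).integral_pos_of_hasCompactSupport_nonneg_nonzero
      (.of_compactSpace _) (fun θ => sub_nonneg.2 (le_max_left _ _)) (x := θ) ?_
    rw [max_eq_right hlt.le]
    exact (sub_pos.2 hlt).ne'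
  have hmean : ENNReal.ofReal
      (∫ θ, max (U (z₀ + r * expCircle θ)) (V (z₀ + r * expCircle θ))) ≤
        ENNReal.ofReal (U z₀) := by
    rw [← hw₀]
    calc _ ≤ _ := ofReal_integral_le_lintegral_ofReal (integrable_of_continuous hmaxc)
      _ ≤ _ := lintegral_mono fun θ => hle _ (add_mul_expCircle_mem_closedBall _ hr.le θ)
      _ ≤ w z₀ := hw.lintegral_le z₀ r hr hrD
  exact ((ENNReal.ofReal_le_ofReal_iff hU₀).1 hmean).not_gt hstrict

end IsNonnegSuperharmonicOn

section Reflection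

variable {Q : ℂ → ℂ} {σ c : ℝ}

/-- The reflection of `Re Q` in the unit circle, corrected by a multiple of `log ‖z‖`, which does
not change the values on the circle but adjusts the radial derivative. -/
noncomputable def reflectedRe (Q : ℂ → ℂ) (c : ℝ) (z : ℂ) : ℝ :=
  (Q (conj z)⁻¹).re - c * log ‖z‖

lemma reflectedRe_of_norm_eq_one {z : ℂ} (hz : ‖z‖ = 1) : reflectedRe Q c z = (Q z).re := by
  rw [reflectedRe, hz, log_one, mul_zero, sub_zero, ← Complex.inv_eq_conj hz, inv_inv]

lemma reflectedRe_mul {t : ℝ} {u : ℂ} (ht : 0 < t) (hu : ‖u‖ = 1) :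
    reflectedRe Q c (t * u) = (Q (u / t)).re - c * log t := by
  have hinv : (conj (t * u))⁻¹ = u / t := by
    rw [map_mul, Complex.conj_ofReal, mul_inv, ← Complex.inv_eq_conj hu, inv_inv, mul_comm,
      div_eq_mul_inv]
  rw [reflectedRe, hinv, norm_mul, hu, mul_one, Complex.norm_real, norm_of_nonneg ht.le]

lemma harmonicOnNhd_re (hQ : DifferentiableOn ℂ Q (ball 0 σ)) :
    HarmonicOnNhd (fun z => (Q z).re) (ball 0 σ) := fun _ hz =>
  (hQ.analyticAt (isOpen_ball.mem_nhds hz)).harmonicAt_re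

lemma harmonicAt_reflectedRe (hσ : 0 < σ) (hQ : DifferentiableOn ℂ Q (ball 0 σ)) (c : ℝ) {z : ℂ}
    (hz : σ⁻¹ < ‖z‖) : HarmonicAt (reflectedRe Q c) z := by
  have hne (x : ℂ) (hx : σ⁻¹ < ‖x‖) : x ≠ 0 := norm_pos_iff.1 ((inv_pos.2 hσ).trans hx)
  have hopen : IsOpen {x : ℂ | σ⁻¹ < ‖x‖} := isOpen_lt continuous_const continuous_norm
  have hdiff : DifferentiableOn ℂ (fun x => conj (Q (conj x⁻¹))) {x : ℂ | σ⁻¹ < ‖x‖} := by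
    intro x hx
    have hQx : DifferentiableAt ℂ Q (conj x⁻¹) := by
      refine hQ.differentiableAt (isOpen_ball.mem_nhds ?_)
      rw [mem_ball_zero_iff, Complex.norm_conj, norm_inv]
      exact inv_lt_of_inv_lt₀ hσ hx
    have hconj : DifferentiableAt ℂ (conj ∘ Q ∘ conj) x⁻¹ := differentiableAt_conj_conj_iff.2 hQx
    exact (hconj.comp (f := fun x : ℂ => x⁻¹) x
      (differentiableAt_inv (hne x hx))).differentiableWithinAt
  have hre := (hdiff.analyticAt (hopen.mem_nhds hz)).harmonicAt_re
  have hlog := (analyticAt_id (𝕜 := ℂ) (z := z)).harmonicAt_log_norm (hne z hz)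
  convert hre.sub (hlog.const_smul (c := c)) using 1
  ext x
  simp [reflectedRe, map_inv₀]

-- Compare `z` with its radial projection `‖z‖⁻¹ • z`, where `F` vanishes.
lemma eventually_sign_of_hasStrictFDerivAt {E : Type*} [NormedAddCommGroup E] [NormedSpace ℝ E]
    {F : E → ℝ} {F' : E →L[ℝ] ℝ} {z₀ : E} (hF : HasStrictFDerivAt F F' z₀) (hz₀ : ‖z₀‖ = 1)
    (hzero : ∀ z, ‖z‖ = 1 → F z = 0) (hpos : 0 < F' z₀) :
    ∀ᶠ z in 𝓝 z₀, (1 < ‖z‖ → 0 < F z) ∧ (‖z‖ ≤ 1 → F z ≤ 0) := by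
  have hne : z₀ ≠ 0 := by
    rintro rfl
    simp at hz₀
  have hproj : Tendsto (fun z : E => ‖z‖⁻¹ • z) (𝓝 z₀) (𝓝 z₀) := by
    have hcont : ContinuousAt (fun z : E => ‖z‖⁻¹ • z) z₀ :=
      (continuousAt_id.norm.inv₀ (norm_ne_zero_iff.2 hne)).smul continuousAt_id
    simpa [ContinuousAt, hz₀] using hcont
  have hstrict : ∀ᶠ z in 𝓝 z₀, ‖F z - F (‖z‖⁻¹ • z) - F' (z - ‖z‖⁻¹ • z)‖ ≤
      F' z₀ / 2 * ‖z - ‖z‖⁻¹ • z‖ :=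
    (tendsto_id.prodMk_nhds hproj).eventually (hF.isLittleO.def (half_pos hpos))
  have hF'pos : ∀ᶠ z in 𝓝 z₀, F' z₀ / 2 < F' (‖z‖⁻¹ • z) :=
    ((F'.continuous.tendsto z₀).comp hproj).eventually (lt_mem_nhds (half_lt_self hpos))
  filter_upwards [hstrict, hF'pos, isOpen_ne.mem_nhds hne] with z hstrict hF'pos hz
  have hunit : ‖‖z‖⁻¹ • z‖ = 1 := by
    rw [norm_smul, norm_inv, norm_norm, inv_mul_cancel₀ (norm_ne_zero_iff.2 hz)]
  have hradial : z - ‖z‖⁻¹ • z = (‖z‖ - 1) • ‖z‖⁻¹ • z := by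
    rw [sub_smul, one_smul, smul_inv_smul₀ (norm_ne_zero_iff.2 hz)]
  rw [hzero _ hunit, sub_zero, hradial, map_smul, smul_eq_mul, norm_smul, hunit, mul_one,
    Real.norm_eq_abs, Real.norm_eq_abs, abs_le] at hstrict
  constructor
  · intro hout
    rw [abs_of_pos (sub_pos.2 hout)] at hstrict
    nlinarith [hstrict.1]
  · intro hin
    rw [abs_of_nonpos (sub_nonpos.2 hin)] at hstrict
    nlinarith [hstrict.2]

lemma hasDerivAt_radial_reflectedRe_sub_re {z₀ : ℂ} (hz₀ : ‖z₀‖ = 1)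
    (hQ : DifferentiableAt ℂ Q z₀) :
    HasDerivAt (fun t : ℝ => reflectedRe Q c (t * z₀) - (Q (t * z₀)).re)
      (-2 * (z₀ * deriv Q z₀).re - c) 1 := by
  have hin : HasDerivAt (fun x : ℂ => Q (z₀ / x)) (deriv Q z₀ * -z₀) (1 : ℝ) := by
    refine HasDerivAt.comp (h₂ := Q) (h := fun x : ℂ => z₀ / x) _ (by simpa using hQ.hasDerivAt) ?_
    simpa using (hasDerivAt_const (1 : ℂ) z₀).fun_div (hasDerivAt_id' 1) one_ne_zero
  have hout : HasDerivAt (fun x : ℂ => Q (x * z₀)) (deriv Q z₀ * z₀) (1 : ℝ) := by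
    refine HasDerivAt.comp (h₂ := Q) (h := fun x : ℂ => x * z₀) _ (by simpa using hQ.hasDerivAt) ?_
    simpa using (hasDerivAt_id (1 : ℂ)).mul_const z₀
  have hlog := (hasDerivAt_log one_ne_zero).const_mul c
  have hsum := (hin.real_of_complex.sub hlog).sub hout.real_of_complex
  refine (hsum.congr_deriv ?_).congr_of_eventuallyEq ?_
  · rw [mul_neg, Complex.neg_re, mul_comm z₀]
    ring
  · filter_upwards [lt_mem_nhds (zero_lt_one' ℝ)] with t ht
    rw [reflectedRe_mul ht hz₀]
    rfl

lemma eventually_sign_reflectedRe_sub_re (hσ : 1 < σ) (hQ : DifferentiableOn ℂ Q (ball 0 σ))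
    {z₀ : ℂ} (hz₀ : ‖z₀‖ = 1) (hlt : (z₀ * deriv Q z₀).re < -c / 2) :
    ∀ᶠ z in 𝓝 z₀, (1 < ‖z‖ → (Q z).re < reflectedRe Q c z) ∧
      (‖z‖ ≤ 1 → reflectedRe Q c z ≤ (Q z).re) := by
  have hmem : z₀ ∈ ball (0 : ℂ) σ := by simpa [hz₀] using hσ
  have hharm : HarmonicAt (fun z => reflectedRe Q c z - (Q z).re) z₀ :=
    HarmonicAt.sub (harmonicAt_reflectedRe (by linarith) hQ c
      (by simpa [hz₀] using inv_lt_one_of_one_lt₀ hσ)) (harmonicOnNhd_re hQ z₀ hmem)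
  have hstrict := hharm.1.hasStrictFDerivAt two_ne_zero
  have hline : HasDerivAt (fun t : ℝ => (t : ℂ) * z₀) z₀ 1 := by
    simpa using (hasDerivAt_id (1 : ℝ)).ofReal_comp.mul_const z₀
  have hradial := HasFDerivAt.comp_hasDerivAt (1 : ℝ) (f := fun t : ℝ => (t : ℂ) * z₀)
    (by simpa using hstrict.hasFDerivAt) hline
  have hderiv := hradial.unique (hasDerivAt_radial_reflectedRe_sub_re (c := c) hz₀
    (hQ.differentiableAt (isOpen_ball.mem_nhds hmem)))
  filter_upwards [eventually_sign_of_hasStrictFDerivAt hstrict hz₀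
    (fun z hz => sub_eq_zero.2 (reflectedRe_of_norm_eq_one hz)) (by linarith)] with z hz
  simpa only [sub_pos, sub_nonpos] using hz

end Reflection

namespace IsNonnegSuperharmonicOn

variable {w : ℂ → ℝ≥0∞} {R ρ σ C : ℝ} {Q : ℂ → ℂ}

lemma ofReal_re_le (hw : IsNonnegSuperharmonicOn w (ball 0 R)) (hR : 1 < R) (hσ : 1 < σ)
    (hQ : DifferentiableOn ℂ Q (ball 0 σ))
    (hbd : ∀ z : ℂ, ‖z‖ = 1 → ENNReal.ofReal (Q z).re ≤ w z) {z : ℂ} (hz : ‖z‖ ≤ 1) :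
    ENNReal.ofReal (Q z).re ≤ w z := by
  refine hw.ofReal_le_of_le_on_diff (U := fun z => (Q z).re) (isCompact_closedBall 0 1)
    isOpen_ball ball_subset_closedBall (closedBall_subset_ball hR)
    (Complex.continuous_re.comp_continuousOn (hQ.continuousOn.mono (closedBall_subset_ball hσ)))
    ((harmonicOnNhd_re hQ).mono (ball_subset_ball hσ.le)) (fun z hz => hbd z ?_)
    (mem_closedBall_zero_iff.2 hz)
  simpa using hz

lemma ofReal_reflectedRe_le (hw : IsNonnegSuperharmonicOn w (ball 0 R)) (hρ : 1 < ρ)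
    (hρR : ρ < R) (hσ : 1 < σ) (hQ : DifferentiableOn ℂ Q (ball 0 σ))
    (hbd : ∀ z : ℂ, ‖z‖ = 1 → ENNReal.ofReal (Q z).re ≤ w z)
    (hC : ∀ z : ℂ, ‖z‖ = ρ⁻¹ → (Q z).re ≤ C) {z : ℂ} (hz : 1 ≤ ‖z‖) (hzρ : ‖z‖ ≤ ρ) :
    ENNReal.ofReal (reflectedRe Q (C / log ρ) z) ≤ w z := by
  have hσinv : σ⁻¹ < 1 := inv_lt_one_of_one_lt₀ hσ
  have hharm (z : ℂ) (hz : 1 ≤ ‖z‖) : HarmonicAt (reflectedRe Q (C / log ρ)) z :=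
    harmonicAt_reflectedRe (by linarith) hQ _ (hσinv.trans_le hz)
  refine hw.ofReal_le_of_le_on_diff ((isCompact_closedBall 0 ρ).diff isOpen_ball)
    (Ω := ball 0 ρ \ closedBall 0 1) (isOpen_ball.sdiff isClosed_closedBall)
    (sdiff_subset_sdiff ball_subset_closedBall ball_subset_closedBall)
    (sdiff_subset.trans (closedBall_subset_ball hρR))
    (fun z hz => (hharm z (by simpa using hz.2)).1.continuousAt.continuousWithinAt)
    (fun z hz => hharm z (by simpa using (le_of_lt (by simpa using hz.2) : 1 ≤ ‖z‖)))
    (fun z hz => ?_) (by simpa using ⟨hzρ, hz⟩)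
  simp only [Set.mem_sdiff, mem_ball_zero_iff, mem_closedBall_zero_iff, not_lt, not_and,
    not_le] at hz
  rcases hz.1.2.eq_or_lt with hone | hone
  · rw [reflectedRe_of_norm_eq_one hone.symm]
    exact hbd z hone.symm
  · have hzρ : ‖z‖ = ρ := hz.1.1.antisymm (not_lt.1 fun h => (hz.2 h).not_gt hone)
    have hre := hC (conj z)⁻¹ (by rw [norm_inv, Complex.norm_conj, hzρ])
    rw [ENNReal.ofReal_of_nonpos]
    · exact zero_le
    · rwa [reflectedRe, hzρ, div_mul_cancel₀ _ (log_pos hρ).ne', sub_nonpos]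

-- If the bound failed, `max (Re Q) (reflectedRe Q _)` would be a minorant of `w` on a small disk
-- around `z₀`, touching `w` at the center, whose mean value exceeds that of `Re Q`.
lemma neg_le_re_mul_deriv (hw : IsNonnegSuperharmonicOn w (ball 0 R)) (hρ : 1 < ρ) (hρR : ρ < R)
    (hσ : 1 < σ) (hQ : DifferentiableOn ℂ Q (ball 0 σ))
    (hbd : ∀ z : ℂ, ‖z‖ = 1 → w z = ENNReal.ofReal (Q z).re)
    (hpos : ∀ z : ℂ, ‖z‖ = 1 → 0 ≤ (Q z).re) (hC : ∀ z : ℂ, ‖z‖ = ρ⁻¹ → (Q z).re ≤ C) {z₀ : ℂ}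
    (hz₀ : ‖z₀‖ = 1) : -(C / log ρ) / 2 ≤ (z₀ * deriv Q z₀).re := by
  by_contra! hlt
  have hnorm {a : ℝ} (ha : 1 < a) : ∀ᶠ z in 𝓝 z₀, z ∈ ball (0 : ℂ) a :=
    isOpen_ball.mem_nhds (by simpa [hz₀] using ha)
  have hnorm' : ∀ᶠ z in 𝓝 z₀, σ⁻¹ < ‖z‖ :=
    continuous_norm.continuousAt.eventually
      (lt_mem_nhds (by simpa [hz₀] using inv_lt_one_of_one_lt₀ hσ))
  obtain ⟨r, hr, hball⟩ := nhds_basis_closedBall.eventually_iff.1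
    ((eventually_sign_reflectedRe_sub_re hσ hQ hz₀ hlt).and
      ((hnorm hρ).and ((hnorm hσ).and hnorm')))
  have hle : ∀ z ∈ closedBall z₀ r,
      ENNReal.ofReal (max (Q z).re (reflectedRe Q (C / log ρ) z)) ≤ w z := by
    intro z hz
    obtain ⟨⟨hout, hin⟩, hzρ, -⟩ := hball hz
    rcases le_or_gt ‖z‖ 1 with hz1 | hz1
    · rw [max_eq_left (hin hz1)]
      exact hw.ofReal_re_le (hρ.trans hρR) hσ hQ (fun z hz => (hbd z hz).ge) hz1
    · rw [max_eq_right (hout hz1).le]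
      exact hw.ofReal_reflectedRe_le hρ hρR hσ hQ (fun z hz => (hbd z hz).ge) hC hz1.le
        (mem_ball_zero_iff.1 hzρ).le
  have htouch := hw.le_on_circle_of_touching (U := fun z => (Q z).re) hr
    (fun z hz => ball_subset_ball hρR.le (hball hz).2.1)
    ((harmonicOnNhd_re hQ).mono fun z hz => (hball hz).2.2.1)
    (fun z hz => (harmonicAt_reflectedRe (by linarith) hQ _
      (hball hz).2.2.2).1.continuousAt.continuousWithinAt) hle (hbd z₀ hz₀) (hpos z₀ hz₀)
  obtain ⟨x, rfl⟩ := exists_expCircle_eq hz₀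
  have hout : 1 < ‖expCircle x + r * expCircle x‖ := by
    rw [← one_add_mul, norm_mul, norm_expCircle, mul_one, ← Complex.ofReal_one,
      ← Complex.ofReal_add, Complex.norm_of_nonneg (by positivity)]
    linarith
  exact ((hball (add_mul_expCircle_mem_closedBall _ hr.le x)).1.1 hout).not_ge (htouch x)

end IsNonnegSuperharmonicOn

section PoissonKernel

variable {ζ : ℂ}

lemma expCircle_sub_ne_zero (hζ : ‖ζ‖ < 1) (x : UnitAddCircle) : expCircle x - ζ ≠ 0 := by
  intro h
  rw [← sub_eq_zero.1 h, norm_expCircle] at hζ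
  exact lt_irrefl _ hζ

lemma poissonKernel_expCircle (ζ : ℂ) (x : UnitAddCircle) :
    poissonKernel 0 ζ (expCircle x) = (1 - ‖ζ‖ ^ 2) / ‖expCircle x - ζ‖ ^ 2 := by
  simp [poissonKernel_def]

lemma poissonKernel_expCircle_nonneg (hζ : ‖ζ‖ < 1) (x : UnitAddCircle) :
    0 ≤ poissonKernel 0 ζ (expCircle x) := by
  rw [poissonKernel_expCircle]
  have hpos : 0 ≤ 1 - ‖ζ‖ ^ 2 := sub_nonneg.2 (pow_le_one₀ (norm_nonneg ζ) hζ.le)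
  positivity

lemma poissonKernel_expCircle_le (hζ : ‖ζ‖ < 1) (x : UnitAddCircle) :
    poissonKernel 0 ζ (expCircle x) ≤ (1 + ‖ζ‖) / (1 - ‖ζ‖) := by
  have hle := re_herglotzRieszKernel_le (c := 0) (R := 1) (z := expCircle x) (w := ζ) (by simp)
    (by simpa using hζ)
  rw [poissonKernel_eq_re_herglotzRieszKernel]
  simpa [herglotzRieszKernel_def] using hle

lemma norm_poissonKernel_expCircle_le (hζ : ‖ζ‖ < 1) (x : UnitAddCircle) :
    ‖poissonKernel 0 ζ (expCircle x)‖ ≤ (1 + ‖ζ‖) / (1 - ‖ζ‖) := by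
  rw [norm_of_nonneg (poissonKernel_expCircle_nonneg hζ x)]
  exact poissonKernel_expCircle_le hζ x

lemma continuous_poissonKernel_expCircle (hζ : ‖ζ‖ < 1) :
    Continuous fun x => poissonKernel 0 ζ (expCircle x) := by
  simp only [poissonKernel_expCircle]
  exact Continuous.div (by fun_prop) (by fun_prop) fun x =>
    pow_ne_zero 2 (norm_ne_zero_iff.2 (expCircle_sub_ne_zero hζ x))

lemma poissonKernel_mul_expCircle (ζ : ℂ) (x y : UnitAddCircle) :
    poissonKernel 0 (ζ * expCircle x) (expCircle y) = poissonKernel 0 ζ (expCircle (y - x)) := by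
  have hrot : expCircle y / expCircle x - ζ = (expCircle y - ζ * expCircle x) / expCircle x := by
    rw [sub_div, mul_div_cancel_right₀ _ (expCircle_ne_zero x)]
  rw [poissonKernel_expCircle, poissonKernel_expCircle, norm_mul, norm_expCircle, mul_one,
    expCircle_sub, hrot, norm_div, norm_expCircle, div_one]

lemma integral_poissonKernel (hζ : ‖ζ‖ < 1) : ∫ x, poissonKernel 0 ζ (expCircle x) = 1 := by
  have hmean := HarmonicOnNhd.circleAverage_poissonKernel_smul (f := fun _ => (1 : ℝ)) (c := 0)
    (R := 1) (w := ζ) (fun z _ => harmonicAt_const 1) (by simpa using hζ)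
  simpa [← integral_comp_expCircle] using hmean

lemma tendstoUniformlyOn_poissonKernel {x : UnitAddCircle} {u : Set UnitAddCircle}
    (hu : IsOpen u) (hxu : x ∈ u) :
    TendstoUniformlyOn (fun (s : ℝ) y => poissonKernel 0 s (expCircle (y - x))) 0 (𝓝[<] 1) uᶜ := by
  obtain ⟨d, hd, hdist⟩ : ∃ d > 0, ∀ y ∈ uᶜ, d ≤ ‖expCircle (y - x) - 1‖ := by
    refine hu.isClosed_compl.isCompact.exists_forall_le' (by fun_prop) fun y hy => ?_
    rw [norm_pos_iff, sub_ne_zero]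
    intro h
    have hinj : y - x = 0 := AddCircle.injective_toCircle (T := 1) one_ne_zero
      (Circle.ext (h.trans expCircle_zero.symm))
    exact hy (sub_eq_zero.1 hinj ▸ hxu)
  have hlim : Tendsto (fun s : ℝ => (1 - s ^ 2) / (d - (1 - s)) ^ 2) (𝓝[<] 1) (𝓝 0) := by
    have hcont : ContinuousAt (fun s : ℝ => (1 - s ^ 2) / (d - (1 - s)) ^ 2) 1 :=
      ContinuousAt.div (by fun_prop) (by fun_prop) (by simpa using hd.ne')
    simpa using hcont.tendsto.mono_left nhdsWithin_le_nhds
  rw [Metric.tendstoUniformlyOn_iff]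
  intro ε hε
  filter_upwards [hlim.eventually (gt_mem_nhds hε),
    Ioo_mem_nhdsLT (max_lt zero_lt_one (sub_lt_self 1 hd))] with s hsε hs y hy
  have hs0 : 0 < s := (le_max_left _ _).trans_lt hs.1
  have hsd : 0 < d - (1 - s) := by linarith [(le_max_right 0 (1 - d)).trans_lt hs.1]
  have hnorm : ‖(s : ℂ)‖ = s := Complex.norm_of_nonneg hs0.le
  have hfar : d - (1 - s) ≤ ‖expCircle (y - x) - s‖ := by
    have htri := norm_sub_le_norm_sub_add_norm_sub (expCircle (y - x)) (s : ℂ) 1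
    have hs1 : ‖(s : ℂ) - 1‖ = 1 - s := by
      rw [norm_sub_rev, ← Complex.ofReal_one, ← Complex.ofReal_sub,
        Complex.norm_of_nonneg (by linarith [hs.2])]
    linarith [hdist y hy]
  rw [Pi.zero_apply, dist_zero_left,
    norm_of_nonneg (poissonKernel_expCircle_nonneg (hnorm.trans_lt hs.2) _),
    poissonKernel_expCircle, hnorm]
  refine lt_of_le_of_lt ?_ hsε
  gcongr
  nlinarith [hs.2]

end PoissonKernel

section HerglotzIntegral

variable {ζ : ℂ} {g : ℂ → ℝ}

/-- The Herglotz integral of a real function on the unit circle: the holomorphic function on the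
unit disk whose real part is the Poisson integral. -/
noncomputable def herglotzIntegral (g : ℂ → ℝ) (ζ : ℂ) : ℂ :=
  circleAverage (fun z => herglotzRieszKernel 0 ζ z • (g z : ℂ)) 0 1

lemma hasDerivAt_herglotzIntegral (hg : Integrable fun x => g (expCircle x)) (hζ : ‖ζ‖ < 1) :
    HasDerivAt (herglotzIntegral g)
      (∫ x, (2 * expCircle x / (expCircle x - ζ) ^ 2) * (g (expCircle x) : ℂ)) ζ := by
  have hderiv := hasDerivAt_circleAverage_herglotzRieszKernel_smul (f := fun z => (g z : ℂ))
    (circleIntegrable_of_integrable_comp_expCircle hg.ofReal) (w := ζ) (by simpa using hζ)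
  rwa [← integral_comp_expCircle] at hderiv

lemma re_herglotzIntegral (hg : Integrable fun x => g (expCircle x)) (hζ : ‖ζ‖ < 1) :
    (herglotzIntegral g ζ).re = ∫ x, poissonKernel 0 ζ (expCircle x) * g (expCircle x) := by
  rw [herglotzIntegral, re_circleAverage_herglotzRieszKernel_smul
    (circleIntegrable_of_integrable_comp_expCircle hg) (by simpa using hζ),
    ← integral_comp_expCircle, poissonKernel_eq_re_herglotzRieszKernel]
  rfl

lemma continuous_herglotzRieszKernel_expCircle (hζ : ‖ζ‖ < 1) :
    Continuous fun x => herglotzRieszKernel 0 ζ (expCircle x) :=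
  (continuousOn_herglotzRieszKernel_sphere (c := 0) (R := 1) (by simpa using hζ)).comp_continuous
    continuous_expCircle (by simp)

lemma integral_herglotzRieszKernel (hζ : ‖ζ‖ < 1) :
    ∫ x, herglotzRieszKernel 0 ζ (expCircle x) = 1 := by
  have hcauchy : ∫ x, expCircle x / (expCircle x - ζ) = 1 := by
    have hmean := (diffContOnCl_const (𝕜 := ℂ) (s := ball (0 : ℂ) |1|)
      (c := (1 : ℂ))).circleAverage_smul_div (R := 1) (w := ζ) (by simpa using hζ)
    simpa [← integral_comp_expCircle] using hmean
  have hcont : Continuous fun x => expCircle x / (expCircle x - ζ) :=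
    Continuous.div (by fun_prop) (by fun_prop) (expCircle_sub_ne_zero hζ)
  have hkernel (x) : herglotzRieszKernel 0 ζ (expCircle x) =
      2 * (expCircle x / (expCircle x - ζ)) - 1 := by
    rw [herglotzRieszKernel_def]
    field_simp [expCircle_sub_ne_zero hζ x]
    ring
  simp_rw [hkernel]
  rw [integral_sub (integrable_of_continuous (hcont.const_mul 2)) (integrable_const 1),
    integral_const_mul, hcauchy]
  norm_num

lemma herglotzIntegral_const_sub (hg : Integrable fun x => g (expCircle x)) (b : ℝ)
    (hζ : ‖ζ‖ < 1) : herglotzIntegral (fun z => b - g z) ζ = b - herglotzIntegral g ζ := by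
  have hK := continuous_herglotzRieszKernel_expCircle hζ
  have hKg : Integrable fun x => herglotzRieszKernel 0 ζ (expCircle x) * (g (expCircle x) : ℂ) := by
    obtain ⟨C, hC⟩ := (isCompact_range hK).isBounded.exists_norm_le
    exact hg.ofReal.bdd_mul hK.aestronglyMeasurable (.of_forall fun x => hC _ (mem_range_self x))
  simp only [herglotzIntegral, ← integral_comp_expCircle, smul_eq_mul, Complex.ofReal_sub, mul_sub]
  rw [integral_sub ((integrable_of_continuous hK).mul_const _) hKg, integral_mul_const,
    integral_herglotzRieszKernel hζ, one_mul]

end HerglotzIntegral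

section PoissonAverage

variable {E : Type*} [NormedAddCommGroup E] [NormedSpace ℝ E] {ζ : ℂ} {h : UnitAddCircle → E}

/-- The Poisson integral of `h` at the point `ζ * expCircle x`, regarded as an average of the
translates of `h`. -/
noncomputable def poissonAverage (ζ : ℂ) (h : UnitAddCircle → E) (x : UnitAddCircle) : E :=
  ∫ y, poissonKernel 0 ζ (expCircle (y - x)) • h y

lemma integrable_poissonKernel_smul (hζ : ‖ζ‖ < 1) (hh : Integrable h) (x : UnitAddCircle) :
    Integrable fun y => poissonKernel 0 ζ (expCircle (y - x)) • h y :=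
  hh.bdd_smul _ ((continuous_poissonKernel_expCircle hζ).comp
    (continuous_sub_right x)).aestronglyMeasurable
    (.of_forall fun _ => norm_poissonKernel_expCircle_le hζ _)

lemma continuous_poissonAverage (hζ : ‖ζ‖ < 1) (hh : Integrable h) :
    Continuous (poissonAverage ζ h) := by
  refine continuous_of_dominated (bound := fun y => (1 + ‖ζ‖) / (1 - ‖ζ‖) * ‖h y‖)
    (fun x => (integrable_poissonKernel_smul hζ hh x).aestronglyMeasurable)
    (fun x => .of_forall fun y => ?_) (hh.norm.const_mul _) (.of_forall fun y =>
      ((continuous_poissonKernel_expCircle hζ).comp (continuous_sub_left y)).smul continuous_const)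
  rw [norm_smul]
  gcongr
  exact norm_poissonKernel_expCircle_le hζ _

lemma integrable_poissonAverage (hζ : ‖ζ‖ < 1) (hh : Integrable h) :
    Integrable (poissonAverage ζ h) :=
  integrable_of_continuous (continuous_poissonAverage hζ hh)

lemma poissonAverage_nonneg (hζ : ‖ζ‖ < 1) {h : UnitAddCircle → ℝ} (hh : ∀ y, 0 ≤ h y)
    (x : UnitAddCircle) : 0 ≤ poissonAverage ζ h x :=
  integral_nonneg fun y => mul_nonneg (poissonKernel_expCircle_nonneg hζ _) (hh y)

lemma norm_poissonAverage_le (hζ : ‖ζ‖ < 1) (h : UnitAddCircle → E) (x : UnitAddCircle) :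
    ‖poissonAverage ζ h x‖ ≤ poissonAverage ζ (fun y => ‖h y‖) x := by
  refine (norm_integral_le_integral_norm _).trans_eq (integral_congr_ae (.of_forall fun y => ?_))
  change ‖poissonKernel 0 ζ (expCircle (y - x)) • h y‖ = _
  rw [norm_smul, norm_of_nonneg (poissonKernel_expCircle_nonneg hζ _)]
  rfl

lemma poissonAverage_sub (hζ : ‖ζ‖ < 1) {g : UnitAddCircle → E} (hg : Integrable g)
    (hh : Integrable h) (x : UnitAddCircle) :
    poissonAverage ζ (fun y => g y - h y) x = poissonAverage ζ g x - poissonAverage ζ h x := by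
  simp only [poissonAverage, smul_sub]
  exact integral_sub (integrable_poissonKernel_smul hζ hg x)
    (integrable_poissonKernel_smul hζ hh x)

lemma integral_poissonKernel_sub_right (hζ : ‖ζ‖ < 1) (x : UnitAddCircle) :
    ∫ y, poissonKernel 0 ζ (expCircle (y - x)) = 1 := by
  rw [integral_sub_right_eq_self (fun y => poissonKernel 0 ζ (expCircle y)) x,
    integral_poissonKernel hζ]

lemma integral_poissonKernel_sub_left (hζ : ‖ζ‖ < 1) (y : UnitAddCircle) :
    ∫ x, poissonKernel 0 ζ (expCircle (y - x)) = 1 := by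
  rw [integral_sub_left_eq_self (fun y => poissonKernel 0 ζ (expCircle y)) volume y,
    integral_poissonKernel hζ]

lemma poissonAverage_le_of_le (hζ : ‖ζ‖ < 1) {h : UnitAddCircle → ℝ} (hh : Integrable h) {C : ℝ}
    (hC : ∀ᵐ y, h y ≤ C) (x : UnitAddCircle) : poissonAverage ζ h x ≤ C := by
  calc poissonAverage ζ h x ≤ ∫ y, poissonKernel 0 ζ (expCircle (y - x)) • C := by
        refine integral_mono_ae (integrable_poissonKernel_smul hζ hh x)
          (integrable_poissonKernel_smul hζ (integrable_const C) x) ?_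
        filter_upwards [hC] with y hy
        exact mul_le_mul_of_nonneg_left hy (poissonKernel_expCircle_nonneg hζ _)
    _ = C := by rw [integral_smul_const, integral_poissonKernel_sub_right hζ, one_smul]

lemma integral_poissonAverage [CompleteSpace E] (hζ : ‖ζ‖ < 1) (hh : Integrable h) :
    ∫ x, poissonAverage ζ h x = ∫ y, h y := by
  have hprod : Integrable (fun p : UnitAddCircle × UnitAddCircle =>
      poissonKernel 0 ζ (expCircle (p.2 - p.1)) • h p.2) (volume.prod volume) :=
    (hh.comp_snd volume).bdd_smul _ ((continuous_poissonKernel_expCircle hζ).comp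
      (continuous_snd.sub continuous_fst)).aestronglyMeasurable
      (.of_forall fun _ => norm_poissonKernel_expCircle_le hζ _)
  calc ∫ x, poissonAverage ζ h x
      = ∫ y, ∫ x, poissonKernel 0 ζ (expCircle (y - x)) • h y := integral_integral_swap hprod
    _ = ∫ y, h y := by
        simp only [integral_smul_const, integral_poissonKernel_sub_left hζ, one_smul]

lemma integral_norm_poissonAverage_le (hζ : ‖ζ‖ < 1) (hh : Integrable h) :
    ∫ x, ‖poissonAverage ζ h x‖ ≤ ∫ x, ‖h x‖ := by
  rw [← integral_poissonAverage hζ hh.norm]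
  exact integral_mono (integrable_poissonAverage hζ hh).norm
    (integrable_poissonAverage hζ hh.norm) (norm_poissonAverage_le hζ h)

lemma eventually_norm_ofReal_lt_one : ∀ᶠ s : ℝ in 𝓝[<] 1, ‖(s : ℂ)‖ < 1 := by
  filter_upwards [Ioo_mem_nhdsLT (zero_lt_one' ℝ)] with s hs
  rw [Complex.norm_of_nonneg hs.1.le]
  exact hs.2

lemma tendsto_poissonAverage [CompleteSpace E] (hh : Continuous h) (x : UnitAddCircle) :
    Tendsto (fun s : ℝ => poissonAverage s h x) (𝓝[<] 1) (𝓝 (h x)) := by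
  refine tendsto_integral_peak_smul_of_integrable_of_tendsto (t := univ) .univ univ_mem (by simp)
    ?_ (fun u hu hxu => tendstoUniformlyOn_poissonKernel hu hxu) ?_ ?_
    (integrable_of_continuous hh) (hh.tendsto x)
  · filter_upwards [eventually_norm_ofReal_lt_one] with s hs y
    exact poissonKernel_expCircle_nonneg hs _
  · refine tendsto_const_nhds.congr' ?_
    filter_upwards [eventually_norm_ofReal_lt_one] with s hs
    rw [setIntegral_univ, integral_poissonKernel_sub_right hs]
  · filter_upwards [eventually_norm_ofReal_lt_one] with s hs
    exact ((continuous_poissonKernel_expCircle hs).comp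
      (continuous_sub_right x)).aestronglyMeasurable

lemma tendsto_integral_norm_poissonAverage_sub_of_continuous [CompleteSpace E]
    (hh : Continuous h) :
    Tendsto (fun s : ℝ => ∫ x, ‖poissonAverage s h x - h x‖) (𝓝[<] 1) (𝓝 0) := by
  obtain ⟨C, hC⟩ := (isCompact_range hh).isBounded.exists_norm_le
  replace hC (y) : ‖h y‖ ≤ C := hC _ (mem_range_self y)
  have hint := integrable_of_continuous (μ := volume) hh
  rw [← integral_zero UnitAddCircle ℝ]
  refine tendsto_integral_filter_of_dominated_convergence (fun _ => C + C) ?_ ?_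
    (integrable_const _) (.of_forall fun x => ?_)
  · filter_upwards [eventually_norm_ofReal_lt_one] with s hs
    exact ((integrable_poissonAverage hs hint).sub hint).norm.aestronglyMeasurable
  · filter_upwards [eventually_norm_ofReal_lt_one] with s hs
    refine .of_forall fun x => ?_
    rw [norm_norm]
    exact (norm_sub_le _ _).trans (add_le_add ((norm_poissonAverage_le hs h x).trans
      (poissonAverage_le_of_le hs hint.norm (.of_forall hC) x)) (hC x))
  · exact tendsto_iff_norm_sub_tendsto_zero.1 (tendsto_poissonAverage hh x)

lemma tendsto_integral_norm_poissonAverage_sub [CompleteSpace E] (hh : Integrable h) :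
    Tendsto (fun s : ℝ => ∫ x, ‖poissonAverage s h x - h x‖) (𝓝[<] 1) (𝓝 0) := by
  rw [Metric.tendsto_nhds]
  intro ε hε
  obtain ⟨g, hg, hgi⟩ := hh.exists_boundedContinuous_integral_sub_le (ε := ε / 3) (by positivity)
  filter_upwards [eventually_norm_ofReal_lt_one,
    (tendsto_integral_norm_poissonAverage_sub_of_continuous g.continuous).eventually
      (gt_mem_nhds (div_pos hε three_pos))] with s hs hgs
  have hsub : Integrable fun x => h x - g x := hh.sub hgi
  have hconv : Integrable fun x => ‖poissonAverage s g x - g x‖ :=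
    ((integrable_poissonAverage hs hgi).sub hgi).norm
  have hdiff : Integrable fun x => ‖poissonAverage s (fun y => h y - g y) x‖ :=
    (integrable_poissonAverage hs hsub).norm
  have hsum : Integrable fun x => ‖poissonAverage s (fun y => h y - g y) x‖ +
      ‖poissonAverage s g x - g x‖ := hdiff.add hconv
  have hpoint (x) : ‖poissonAverage s h x - h x‖ ≤
      ‖poissonAverage s (fun y => h y - g y) x‖ + ‖poissonAverage s g x - g x‖ + ‖h x - g x‖ := by
    rw [poissonAverage_sub hs hh hgi, ← norm_neg (h x - g x)]
    refine le_trans (le_of_eq ?_) (norm_add₃_le (a := _))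
    congr 1
    abel
  rw [dist_zero_right, norm_of_nonneg (integral_nonneg fun x => norm_nonneg _)]
  calc ∫ x, ‖poissonAverage s h x - h x‖
      ≤ ∫ x, (‖poissonAverage s (fun y => h y - g y) x‖ + ‖poissonAverage s g x - g x‖ +
          ‖h x - g x‖) :=
        integral_mono ((integrable_poissonAverage hs hh).sub hh).norm
          (hsum.add hsub.norm) hpoint
    _ = (∫ x, ‖poissonAverage s (fun y => h y - g y) x‖) + (∫ x, ‖poissonAverage s g x - g x‖) +
          ∫ x, ‖h x - g x‖ := by
        rw [integral_add hsum hsub.norm, integral_add hdiff hconv]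
    _ < ε := by linarith [(integral_norm_poissonAverage_le hs hsub).trans hg]

lemma exists_seq_tendsto_poissonAverage [CompleteSpace E] (hh : Integrable h) :
    ∃ s : ℕ → ℝ, (∀ n, s n ∈ Ioo 0 1) ∧
      ∀ᵐ x, Tendsto (fun n => poissonAverage (s n) h x) atTop (𝓝 (h x)) := by
  obtain ⟨u, -, hu, hulim⟩ := exists_seq_strictMono_tendsto' (zero_lt_one' ℝ)
  have hint (n) : Integrable (poissonAverage (u n) h) :=
    integrable_poissonAverage (by rw [Complex.norm_of_nonneg (hu n).1.le]; exact (hu n).2) hh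
  have hL1 : Tendsto (fun n => ∫ x, ‖poissonAverage (u n) h x - h x‖) atTop (𝓝 0) :=
    (tendsto_integral_norm_poissonAverage_sub hh).comp
      (tendsto_nhdsWithin_iff.2 ⟨hulim, .of_forall fun n => (hu n).2⟩)
  have hmeasure : TendstoInMeasure volume (fun n => poissonAverage (u n) h) atTop h := by
    refine tendstoInMeasure_of_tendsto_eLpNorm one_ne_zero
      (fun n => (hint n).aestronglyMeasurable) hh.aestronglyMeasurable ?_
    have heLp (n) : eLpNorm (poissonAverage (u n) h - h) 1 volume =
        ENNReal.ofReal (∫ x, ‖poissonAverage (u n) h x - h x‖) := by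
      rw [eLpNorm_one_eq_lintegral_enorm, ← ofReal_integral_norm_eq_lintegral_enorm
        ((hint n).sub hh)]
      rfl
    simpa [heLp] using ENNReal.tendsto_ofReal hL1
  obtain ⟨k, -, hk⟩ := hmeasure.exists_seq_tendsto_ae
  exact ⟨u ∘ k, fun n => hu (k n), hk⟩

end PoissonAverage

section Arcs

lemma hasDerivAt_expCircle_coe (t : ℝ) :
    HasDerivAt (fun t : ℝ => expCircle t) (2 * π * Complex.I * expCircle t) t := by
  have hexp : HasDerivAt (fun z : ℂ => Complex.exp (2 * π * z * Complex.I))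
      (Complex.exp (2 * π * t * Complex.I) * (2 * π * Complex.I)) t := by
    refine HasDerivAt.cexp ?_
    simpa using ((hasDerivAt_id (t : ℂ)).const_mul (2 * π : ℂ)).mul_const Complex.I
  simp only [expCircle_coe]
  exact hexp.comp_ofReal.congr_deriv (mul_comm _ _)

@[fun_prop]
lemma continuous_expCircle_coe : Continuous fun t : ℝ => expCircle t :=
  continuous_expCircle.comp (AddCircle.continuous_mk' 1)

lemma norm_expCircle_coe_sub_one_le (t : ℝ) : ‖expCircle t - 1‖ ≤ 2 * π * |t| := by
  have hchord := Real.norm_exp_I_mul_ofReal_sub_one_le (x := 2 * π * t)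
  rw [norm_eq_abs, abs_mul, abs_of_pos two_pi_pos] at hchord
  rw [expCircle_coe]
  convert hchord using 4
  push_cast
  ring

lemma norm_expCircle_sub_ofReal_sq (x : UnitAddCircle) (r : ℝ) :
    ‖expCircle x - r‖ ^ 2 = (1 - r) ^ 2 + r * ‖expCircle x - 1‖ ^ 2 := by
  have hone : (expCircle x).re * (expCircle x).re + (expCircle x).im * (expCircle x).im = 1 := by
    rw [← Complex.normSq_apply, Complex.normSq_eq_norm_sq, norm_expCircle, one_pow]
  simp only [← Complex.normSq_eq_norm_sq, Complex.normSq_apply, Complex.sub_re, Complex.sub_im,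
    Complex.ofReal_re, Complex.ofReal_im, Complex.one_re, Complex.one_im]
  linear_combination (1 - r) * hone

lemma one_le_mul_poissonKernel {r : ℝ} (hr0 : 0 ≤ r) (hr1 : r < 1) {x : UnitAddCircle}
    (hx : ‖expCircle x - 1‖ ≤ 1 - r) :
    1 ≤ 2 * (1 - r) / (1 + r) * poissonKernel 0 r (expCircle x) := by
  have hr : 0 < 1 - r := sub_pos.2 hr1
  have hdenom : ‖expCircle x - r‖ ^ 2 ≤ 2 * (1 - r) ^ 2 := by
    have hsq : ‖expCircle x - 1‖ ^ 2 ≤ (1 - r) ^ 2 := by gcongr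
    rw [norm_expCircle_sub_ofReal_sq]
    nlinarith [sq_nonneg (1 - r)]
  have hdenom_pos : 0 < ‖expCircle x - r‖ ^ 2 := by
    rw [norm_expCircle_sub_ofReal_sq]
    positivity
  rw [poissonKernel_expCircle, Complex.norm_of_nonneg hr0, mul_div_assoc', one_le_div hdenom_pos]
  refine hdenom.trans_eq ?_
  field_simp
  ring

lemma intervalIntegral_coe_le_integral {f : UnitAddCircle → ℝ} (hf : Continuous f)
    (hf0 : ∀ y, 0 ≤ f y) {a b : ℝ} (hab : a ≤ b) (hba : b ≤ a + 1) :
    ∫ t in a..b, f t ≤ ∫ y, f y := by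
  rw [← UnitAddCircle.intervalIntegral_preimage a f]
  exact intervalIntegral.integral_mono_interval le_rfl hab hba (.of_forall fun t => hf0 t)
    ((hf.comp (AddCircle.continuous_mk' 1)).intervalIntegrable _ _)

-- On the arc of length `δ` the Poisson kernel at distance `π * δ` from its midpoint is at least
-- `(1 + r) / (2 * (1 - r))`.
lemma intervalIntegral_le_poissonAverage {m : UnitAddCircle → ℝ} (hm : Continuous m)
    (hm0 : ∀ y, 0 ≤ m y) {δ r : ℝ} (hδ : 0 < δ) (hr : 1 - r = π * δ) (hr0 : 0 ≤ r) (x : ℝ) :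
    ∫ t in x..x + δ, m t ≤
      2 * (1 - r) / (1 + r) * poissonAverage r m ((x + δ / 2 : ℝ) : UnitAddCircle) := by
  set y : UnitAddCircle := ((x + δ / 2 : ℝ) : UnitAddCircle)
  have hr1 : r < 1 := by nlinarith [pi_pos]
  have hnorm : ‖(r : ℂ)‖ < 1 := by rwa [Complex.norm_of_nonneg hr0]
  have hcoef : 0 ≤ 2 * (1 - r) / (1 + r) := div_nonneg (by linarith) (by linarith)
  have harc (t : ℝ) (ht : t ∈ Icc x (x + δ)) :
      1 ≤ 2 * (1 - r) / (1 + r) * poissonKernel 0 r (expCircle (t - y)) := by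
    refine one_le_mul_poissonKernel hr0 hr1 ?_
    have hdist : |t - (x + δ / 2)| ≤ δ / 2 := abs_le.2 ⟨by linarith [ht.1], by linarith [ht.2]⟩
    calc ‖expCircle (t - y) - 1‖ ≤ 2 * π * |t - (x + δ / 2)| := norm_expCircle_coe_sub_one_le _
      _ ≤ 2 * π * (δ / 2) := by gcongr
      _ = 1 - r := by rw [hr]; ring
  have hcont : Continuous fun z =>
      2 * (1 - r) / (1 + r) * poissonKernel 0 r (expCircle (z - y)) * m z :=
    (((continuous_poissonKernel_expCircle hnorm).comp (continuous_sub_right y)).const_mul _).mul hm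
  calc ∫ t in x..x + δ, m t
      ≤ ∫ t in x..x + δ, 2 * (1 - r) / (1 + r) * poissonKernel 0 r (expCircle (t - y)) * m t :=
        intervalIntegral.integral_mono_on (by linarith)
          ((hm.comp (AddCircle.continuous_mk' 1)).intervalIntegrable _ _)
          ((hcont.comp (AddCircle.continuous_mk' 1)).intervalIntegrable _ _)
          fun t ht => le_mul_of_one_le_left (hm0 _) (harc t ht)
    _ ≤ ∫ z, 2 * (1 - r) / (1 + r) * poissonKernel 0 r (expCircle (z - y)) * m z :=
        intervalIntegral_coe_le_integral hcont
          (fun z => mul_nonneg (mul_nonneg hcoef (poissonKernel_expCircle_nonneg hnorm _)) (hm0 z))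
          (by linarith) (by nlinarith [pi_gt_three])
    _ = 2 * (1 - r) / (1 + r) * poissonAverage r m y := by
        simp only [mul_assoc, integral_const_mul]
        rfl

lemma poissonAverage_of_harmonicOnNhd {f : ℂ → ℝ} (hf : HarmonicOnNhd f (closedBall 0 1)) {ζ : ℂ}
    (hζ : ‖ζ‖ < 1) (x : UnitAddCircle) :
    poissonAverage ζ (fun y => f (expCircle y)) x = f (ζ * expCircle x) := by
  rw [← hf.circleAverage_poissonKernel_smul (w := ζ * expCircle x) (by simpa using hζ),
    ← integral_comp_expCircle]
  simp only [Pi.smul_apply', poissonKernel_mul_expCircle]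
  rfl

end Arcs

section ArcAverage

variable {E F : Type*} [NormedAddCommGroup E] [NormedSpace ℝ E] [NormedAddCommGroup F]
  [NormedSpace ℝ F] {f : ℂ → E} {Q : ℂ → ℂ} {σ δ : ℝ}

/-- The average of `f` over the arc of half-width `δ` (in turns) centred at `z` on the circle
through `z` around the origin. -/
noncomputable def arcAverage (f : ℂ → E) (δ : ℝ) (z : ℂ) : E :=
  (2 * δ)⁻¹ • ∫ t in -δ..δ, f (z * expCircle t)

lemma arcAverage_zero [CompleteSpace E] (hδ : δ ≠ 0) : arcAverage f δ 0 = f 0 := by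
  simp only [arcAverage, zero_mul, intervalIntegral.integral_const, smul_smul]
  rw [show (2 * δ)⁻¹ * (δ - -δ) = 1 by field_simp; norm_num, one_smul]

lemma arcAverage_expCircle (f : ℂ → E) (δ : ℝ) (x : UnitAddCircle) :
    arcAverage f δ (expCircle x) = (2 * δ)⁻¹ • ∫ t in -δ..δ, f (expCircle (x + t)) := by
  simp only [arcAverage, expCircle_add]

lemma map_arcAverage [CompleteSpace E] [CompleteSpace F] (L : E →L[ℝ] F) {z : ℂ}
    (hf : Continuous fun t : ℝ => f (z * expCircle t)) :
    L (arcAverage f δ z) = arcAverage (fun z => L (f z)) δ z := by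
  rw [arcAverage, map_smul, ← L.intervalIntegral_comp_comm (hf.intervalIntegrable _ _), arcAverage]

lemma continuous_comp_mul_expCircle_coe {X : Type*} [TopologicalSpace X] {f : ℂ → X}
    (hf : ContinuousOn f (ball 0 σ)) {z : ℂ} (hz : z ∈ ball (0 : ℂ) σ) :
    Continuous fun t : ℝ => f (z * expCircle t) :=
  hf.comp_continuous (by fun_prop) fun t => mul_expCircle_mem_ball hz t

lemma differentiableOn_arcAverage (hQ : DifferentiableOn ℂ Q (ball 0 σ)) :
    DifferentiableOn ℂ (arcAverage Q δ) (ball 0 σ) := by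
  refine DifferentiableOn.const_smul (fun z hz => ?_) _
  obtain ⟨τ, hzτ, hτσ⟩ := exists_between (mem_ball_zero_iff.1 hz)
  have hnhds : ball (0 : ℂ) τ ∈ 𝓝 z := isOpen_ball.mem_nhds (mem_ball_zero_iff.2 hzτ)
  have hsub : closedBall (0 : ℂ) τ ⊆ ball 0 σ := closedBall_subset_ball hτσ
  have hdQ : ContinuousOn (deriv Q) (ball 0 σ) := (hQ.deriv isOpen_ball).continuousOn
  obtain ⟨C, hC⟩ := (isCompact_closedBall (0 : ℂ) τ).exists_bound_of_continuousOn (hdQ.mono hsub)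
  have hmem {x : ℂ} (hx : x ∈ ball (0 : ℂ) τ) (t : ℝ) : x * expCircle t ∈ closedBall (0 : ℂ) τ :=
    ball_subset_closedBall (mul_expCircle_mem_ball hx t)
  refine (intervalIntegral.hasDerivAt_integral_of_dominated_loc_of_deriv_le
    (F := fun x (t : ℝ) => Q (x * expCircle t))
    (F' := fun x (t : ℝ) => deriv Q (x * expCircle t) * expCircle t) (bound := fun _ => C) hnhds
    ?_ ?_ ?_ ?_ intervalIntegrable_const ?_).2.differentiableAt.differentiableWithinAt
  · filter_upwards [isOpen_ball.mem_nhds hz] with x hx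
    exact (continuous_comp_mul_expCircle_coe hQ.continuousOn hx).aestronglyMeasurable
  · exact (continuous_comp_mul_expCircle_coe hQ.continuousOn hz).intervalIntegrable _ _
  · exact ((continuous_comp_mul_expCircle_coe hdQ hz).mul
      continuous_expCircle_coe).aestronglyMeasurable
  · refine .of_forall fun t _ x hx => ?_
    rw [norm_mul, norm_expCircle, mul_one]
    exact hC _ (hmem hx t)
  · refine .of_forall fun t _ x hx => ?_
    have hderiv := (hQ.differentiableAt (isOpen_ball.mem_nhds (hsub (hmem hx t)))).hasDerivAt
    exact hderiv.comp x (by simpa using (hasDerivAt_id x).mul_const (expCircle t))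

end ArcAverage

section MonotoneAverage

variable {M F : ℝ → ℝ} {δ A κ : ℝ}

lemma abs_integral_sub_le_of_monotone (hM : Monotone M) (hδ : 0 ≤ δ)
    (hinc : ∀ t, M (t + δ) - M t ≤ A) (x : ℝ) : |∫ t in -δ..δ, (M (x + t) - M x)| ≤ δ * A := by
  have hshift : Monotone fun t => M (x + t) - M x := fun s t hst =>
    sub_le_sub_right (hM (by linarith)) _
  have hint (a b : ℝ) : IntervalIntegrable (fun t => M (x + t) - M x) volume a b :=
    hshift.intervalIntegrable
  have hright_nonneg : 0 ≤ ∫ t in (0)..δ, (M (x + t) - M x) :=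
    intervalIntegral.integral_nonneg hδ fun t ht => sub_nonneg.2 (hM (by linarith [ht.1]))
  have hright_le : ∫ t in (0)..δ, (M (x + t) - M x) ≤ ∫ _ in (0)..δ, A := by
    refine intervalIntegral.integral_mono_on hδ (hint _ _) intervalIntegrable_const fun t ht => ?_
    linarith [hinc x, hM (show x + t ≤ x + δ by linarith [ht.2])]
  have hleft_nonpos : ∫ t in -δ..0, (M (x + t) - M x) ≤ ∫ _ in -δ..0, (0 : ℝ) :=
    intervalIntegral.integral_mono_on (by linarith) (hint _ _) intervalIntegrable_const
      fun t ht => sub_nonpos.2 (hM (by linarith [ht.2]))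
  have hleft_ge : ∫ _ in -δ..0, -A ≤ ∫ t in -δ..0, (M (x + t) - M x) := by
    refine intervalIntegral.integral_mono_on (by linarith) intervalIntegrable_const (hint _ _)
      fun t ht => ?_
    have hstep := hinc (x - δ)
    rw [sub_add_cancel] at hstep
    linarith [hM (show x - δ ≤ x + t by linarith [ht.1])]
  simp only [intervalIntegral.integral_const, smul_eq_mul] at hright_le hleft_nonpos hleft_ge
  rw [← intervalIntegral.integral_add_adjacent_intervals (hint (-δ) 0) (hint 0 δ), abs_le]
  constructor <;> linarith

-- The linear term integrates to zero over the symmetric interval.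
lemma abs_sub_inv_mul_integral_le (hF : Continuous F) (hmono : Monotone fun t => κ * t - F t)
    (hδ : 0 < δ) (hinc : ∀ t, (κ * (t + δ) - F (t + δ)) - (κ * t - F t) ≤ 2 * A) (x : ℝ) :
    |F x - (2 * δ)⁻¹ * ∫ t in -δ..δ, F (x + t)| ≤ A := by
  have hint {G : ℝ → ℝ} (hG : Continuous G) : IntervalIntegrable G volume (-δ) δ :=
    hG.intervalIntegrable _ _
  have hosc := abs_integral_sub_le_of_monotone hmono hδ.le hinc x
  have hlinear : ∫ t in -δ..δ, (κ * (x + t) - F (x + t) - (κ * x - F x)) =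
      2 * δ * F x - ∫ t in -δ..δ, F (x + t) := by
    have hsplit (t) : κ * (x + t) - F (x + t) - (κ * x - F x) = κ * t + F x - F (x + t) := by ring
    simp only [hsplit]
    rw [intervalIntegral.integral_sub (hint (by fun_prop)) (hint (by fun_prop)),
      intervalIntegral.integral_add (hint (by fun_prop)) (hint (by fun_prop)),
      intervalIntegral.integral_const_mul, integral_id, intervalIntegral.integral_const,
      smul_eq_mul]
    ring
  have hscale : F x - (2 * δ)⁻¹ * ∫ t in -δ..δ, F (x + t) =
      (2 * δ)⁻¹ * (2 * δ * F x - ∫ t in -δ..δ, F (x + t)) := by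
    field_simp
  rw [hscale, ← hlinear, abs_mul, abs_of_pos (by positivity), inv_mul_le_iff₀ (by positivity)]
  linarith

end MonotoneAverage

section ConjugateOscillation

variable {Q : ℂ → ℂ} {σ κ δ r D : ℝ}

lemma expCircle_mem_ball (hσ : 1 < σ) (x : UnitAddCircle) : expCircle x ∈ ball (0 : ℂ) σ := by
  rwa [mem_ball_zero_iff, norm_expCircle]

lemma hasDerivAt_im_comp_expCircle (hσ : 1 < σ) (hQ : DifferentiableOn ℂ Q (ball 0 σ)) (t : ℝ) :
    HasDerivAt (fun t : ℝ => (Q (expCircle t)).im)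
      (2 * π * (expCircle t * deriv Q (expCircle t)).re) t := by
  have hderiv := (hQ.differentiableAt
    (isOpen_ball.mem_nhds (expCircle_mem_ball hσ t))).hasDerivAt
  refine ((Complex.imCLM.hasFDerivAt).comp_hasDerivAt t
    (hderiv.scomp t (hasDerivAt_expCircle_coe t))).congr_deriv ?_
  simp only [Complex.imCLM_apply, smul_eq_mul, Complex.mul_im, Complex.mul_re, Complex.I_re,
    Complex.I_im, Complex.re_ofNat, Complex.im_ofNat, Complex.ofReal_re, Complex.ofReal_im]
  ring

lemma hasDerivAt_mul_sub_im_comp_expCircle (hσ : 1 < σ) (hQ : DifferentiableOn ℂ Q (ball 0 σ))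
    (κ t : ℝ) : HasDerivAt (fun t : ℝ => κ * t - (Q (expCircle t)).im)
      (κ - 2 * π * (expCircle t * deriv Q (expCircle t)).re) t := by
  refine (((hasDerivAt_id t).const_mul κ).sub
    (hasDerivAt_im_comp_expCircle hσ hQ t)).congr_deriv ?_
  rw [mul_one]

lemma harmonicOnNhd_const_sub_re_mul_deriv (hQ : DifferentiableOn ℂ Q (ball 0 σ)) (κ : ℝ) :
    HarmonicOnNhd (fun z => κ - 2 * π * (z * deriv Q z).re) (ball 0 σ) := by
  have hdiff : DifferentiableOn ℂ (fun z => (κ : ℂ) - ((2 * π : ℝ) : ℂ) * (z * deriv Q z))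
      (ball 0 σ) :=
    (differentiableOn_const _).sub ((differentiableOn_id.mul (hQ.deriv isOpen_ball)).const_mul _)
  convert harmonicOnNhd_re hdiff using 2 with z
  rw [Complex.sub_re, Complex.ofReal_re, Complex.re_ofReal_mul]

lemma mul_sub_im_increment_le (hσ : 1 < σ) (hQ : DifferentiableOn ℂ Q (ball 0 σ)) (hδ : 0 < δ)
    (hr : 1 - r = π * δ) (hr0 : 0 ≤ r) (hκ : ∀ z : ℂ, ‖z‖ = 1 → 2 * π * (z * deriv Q z).re ≤ κ)
    (hD : ∀ z : ℂ, ‖z‖ = r → -(2 * π * (z * deriv Q z).re) ≤ D) (x : ℝ) :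
    (κ * (x + δ) - (Q (expCircle ((x + δ : ℝ) : UnitAddCircle))).im) -
      (κ * x - (Q (expCircle x)).im) ≤ 2 * ((1 - r) / (1 + r) * (κ + D)) := by
  have hr1 : r < 1 := by nlinarith [pi_pos]
  set u : ℂ → ℝ := fun z => κ - 2 * π * (z * deriv Q z).re
  have hharm : HarmonicOnNhd u (ball 0 σ) := harmonicOnNhd_const_sub_re_mul_deriv hQ κ
  have hcontOn : ContinuousOn u (ball 0 σ) := fun z hz =>
    (hharm z hz).1.continuousAt.continuousWithinAt
  have hcont : Continuous fun y => u (expCircle y) :=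
    hcontOn.comp_continuous continuous_expCircle (expCircle_mem_ball hσ)
  have hzn : ‖r * expCircle ((x + δ / 2 : ℝ) : UnitAddCircle)‖ = r := by
    rw [norm_mul, norm_expCircle, mul_one, Complex.norm_of_nonneg hr0]
  rw [← intervalIntegral.integral_eq_sub_of_hasDerivAt
    (fun t _ => hasDerivAt_mul_sub_im_comp_expCircle hσ hQ κ t)
    ((hcont.comp (AddCircle.continuous_mk' 1)).intervalIntegrable _ _)]
  calc ∫ t in x..x + δ, u (expCircle t)
      ≤ 2 * (1 - r) / (1 + r) *
          poissonAverage r (fun y => u (expCircle y)) ((x + δ / 2 : ℝ) : UnitAddCircle) :=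
        intervalIntegral_le_poissonAverage hcont
          (fun y => sub_nonneg.2 (hκ _ (norm_expCircle y))) hδ hr hr0 x
    _ = 2 * (1 - r) / (1 + r) * u (r * expCircle ((x + δ / 2 : ℝ) : UnitAddCircle)) := by
        rw [poissonAverage_of_harmonicOnNhd (hharm.mono (closedBall_subset_ball hσ))
          (by rwa [Complex.norm_of_nonneg hr0])]
    _ ≤ 2 * (1 - r) / (1 + r) * (κ + D) := by
        refine mul_le_mul_of_nonneg_left ?_ (div_nonneg (by linarith) (by linarith))
        linarith [hD _ hzn]
    _ = 2 * ((1 - r) / (1 + r) * (κ + D)) := by ring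

lemma abs_im_sub_arcAverage_le (hσ : 1 < σ) (hQ : DifferentiableOn ℂ Q (ball 0 σ)) (hδ : 0 < δ)
    (hr : 1 - r = π * δ) (hr0 : 0 ≤ r) (hκ : ∀ z : ℂ, ‖z‖ = 1 → 2 * π * (z * deriv Q z).re ≤ κ)
    (hD : ∀ z : ℂ, ‖z‖ = r → -(2 * π * (z * deriv Q z).re) ≤ D) (x : UnitAddCircle) :
    |(Q (expCircle x) - arcAverage Q δ (expCircle x)).im| ≤ (1 - r) / (1 + r) * (κ + D) := by
  induction x using QuotientAddGroup.induction_on with | _ x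
  have hmono : Monotone fun t : ℝ => κ * t - (Q (expCircle t)).im :=
    monotone_of_hasDerivAt_nonneg (hasDerivAt_mul_sub_im_comp_expCircle hσ hQ κ)
      fun t => sub_nonneg.2 (hκ _ (norm_expCircle t))
  have hcont : Continuous fun t : ℝ => (Q (expCircle t)).im :=
    Complex.continuous_im.comp
      (hQ.continuousOn.comp_continuous continuous_expCircle_coe fun t => expCircle_mem_ball hσ t)
  have him : (arcAverage Q δ (expCircle x)).im = (2 * δ)⁻¹ *
      ∫ t in -δ..δ, (Q (expCircle ((x + t : ℝ) : UnitAddCircle))).im := by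
    rw [← Complex.imCLM_apply, map_arcAverage _ (continuous_comp_mul_expCircle_coe
      hQ.continuousOn (expCircle_mem_ball hσ x)), arcAverage_expCircle]
    rfl
  rw [Complex.sub_im, him]
  exact abs_sub_inv_mul_integral_le hcont hmono hδ
    (mul_sub_im_increment_le hσ hQ hδ hr hr0 hκ hD) x

end ConjugateOscillation

section ExponentialIntegrability

variable {Q : ℂ → ℂ} {σ δ : ℝ}

lemma re_complex_cosh (z : ℂ) : (Complex.cosh z).re = cosh z.re * cos z.im := by
  conv_lhs => rw [← Complex.re_add_im z, Complex.cosh_add, Complex.cosh_mul_I, Complex.sinh_mul_I,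
    ← Complex.ofReal_cosh, ← Complex.ofReal_cos, ← Complex.ofReal_sinh, ← Complex.ofReal_sin]
  simp only [Complex.add_re, Complex.mul_re, Complex.mul_im, Complex.ofReal_re, Complex.ofReal_im,
    Complex.I_re, Complex.I_im]
  ring

lemma integral_cosh_re_le (hQ : DiffContOnCl ℂ Q (ball 0 1)) (h0 : Q 0 = 0) {α : ℝ}
    (hα : α < π / 2) (him : ∀ x, |(Q (expCircle x)).im| ≤ α) :
    ∫ x, cosh (Q (expCircle x)).re ≤ (cos α)⁻¹ := by
  have hα0 : 0 ≤ α := (abs_nonneg _).trans (him 0)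
  have hcos : 0 < cos α := cos_pos_of_mem_Ioo ⟨by linarith [pi_pos], hα⟩
  have hQc : Continuous fun x => Q (expCircle x) :=
    hQ.continuousOn_ball.comp_continuous continuous_expCircle (by simp)
  have hcosh : Continuous fun x => cosh (Q (expCircle x)).re :=
    continuous_cosh.comp (Complex.continuous_re.comp hQc)
  have hcos_im : Continuous fun x => cos (Q (expCircle x)).im :=
    continuous_cos.comp (Complex.continuous_im.comp hQc)
  have hmean : ∫ x, Complex.cosh (Q (expCircle x)) = 1 := by
    have hdiff : DiffContOnCl ℂ (fun z => Complex.cosh (Q z)) (ball 0 |1|) := by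
      rw [abs_one]
      exact Complex.differentiable_cosh.comp_diffContOnCl hQ
    rw [integral_comp_expCircle (fun z => Complex.cosh (Q z)), hdiff.circleAverage, h0,
      Complex.cosh_zero]
  have hre : ∫ x, cosh (Q (expCircle x)).re * cos (Q (expCircle x)).im = 1 := by
    simp only [← re_complex_cosh]
    exact (Complex.reCLM.integral_comp_comm
      (integrable_of_continuous (Complex.continuous_cosh.comp hQc))).trans
        (congrArg Complex.re hmean)
  rw [← one_div, le_div_iff₀ hcos, ← integral_mul_const]
  refine (integral_mono ((integrable_of_continuous hcosh).mul_const _)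
    (integrable_of_continuous (hcosh.mul hcos_im)) fun x => ?_).trans_eq hre
  refine mul_le_mul_of_nonneg_left ?_ (cosh_pos _).le
  exact (cos_le_cos_of_nonneg_of_le_pi (abs_nonneg _) (by linarith [pi_pos]) (him x)).trans_eq
    (cos_abs _)

lemma exp_mul_abs_le_cosh {a b c G : ℝ} (ha : 0 ≤ a) (h : |b| ≤ |c| + G) :
    exp (a * |b|) ≤ 2 * exp (a * G) * cosh (a * c) := by
  calc exp (a * |b|) ≤ exp (a * G + |a * c|) := by
        rw [abs_mul, abs_of_nonneg ha]
        gcongr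
        nlinarith
    _ = exp (a * G) * exp |a * c| := exp_add _ _
    _ ≤ exp (a * G) * (exp (a * c) + exp (-(a * c))) := by
        gcongr
        exact exp_abs_le _
    _ = 2 * exp (a * G) * cosh (a * c) := by rw [cosh_eq]; ring

lemma integral_exp_abs_re_le (hσ : 1 < σ) (hQ : DifferentiableOn ℂ Q (ball 0 σ)) (hδ : δ ≠ 0)
    {A G a : ℝ} (him : ∀ x, |(Q (expCircle x) - arcAverage Q δ (expCircle x)).im| ≤ A)
    (hG : ∀ x, |arcAverage (fun z => (Q z).re) δ (expCircle x)| ≤ G) (ha : 0 ≤ a)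
    (haA : a * A < π / 2) :
    ∫ x, exp (a * |(Q (expCircle x)).re|) ≤ 2 * exp (a * G) * (cos (a * A))⁻¹ := by
  set P : ℂ → ℂ := fun z => Q z - arcAverage Q δ z with hP
  have hPdiff : DifferentiableOn ℂ P (ball 0 σ) := hQ.sub (differentiableOn_arcAverage hQ)
  have hre_cont {f : ℂ → ℂ} (hf : DifferentiableOn ℂ f (ball 0 σ)) :
      Continuous fun x => (f (expCircle x)).re :=
    Complex.continuous_re.comp
      (hf.continuousOn.comp_continuous continuous_expCircle (expCircle_mem_ball hσ))
  have hcosh : ∫ x, cosh (a * (P (expCircle x)).re) ≤ (cos (a * A))⁻¹ := by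
    simp only [← Complex.re_ofReal_mul]
    refine integral_cosh_re_le (Q := fun z => a * P z) ?_ ?_ haA fun x => ?_
    · exact ((hPdiff.const_mul _).mono (closure_ball_subset_closedBall.trans
        (closedBall_subset_ball hσ))).diffContOnCl
    · simp [hP, arcAverage_zero hδ]
    · rw [Complex.im_ofReal_mul, abs_mul, abs_of_nonneg ha]
      exact mul_le_mul_of_nonneg_left (him x) ha
  have hre (x) : |(Q (expCircle x)).re| ≤ |(P (expCircle x)).re| + G := by
    have harc : (arcAverage Q δ (expCircle x)).re =
        arcAverage (fun z => (Q z).re) δ (expCircle x) :=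
      map_arcAverage Complex.reCLM
        (continuous_comp_mul_expCircle_coe hQ.continuousOn (expCircle_mem_ball hσ x))
    have hsplit : (Q (expCircle x)).re =
        (P (expCircle x)).re + arcAverage (fun z => (Q z).re) δ (expCircle x) := by
      rw [← harc, Complex.sub_re, sub_add_cancel]
    rw [hsplit]
    exact (abs_add_le _ _).trans (add_le_add_right (hG x) _)
  calc ∫ x, exp (a * |(Q (expCircle x)).re|)
      ≤ ∫ x, 2 * exp (a * G) * cosh (a * (P (expCircle x)).re) :=
        integral_mono
          (integrable_of_continuous (continuous_exp.comp ((hre_cont hQ).abs.const_mul a)))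
          ((integrable_of_continuous
            (continuous_cosh.comp ((hre_cont hPdiff).const_mul a))).const_mul _)
          fun x => exp_mul_abs_le_cosh ha (hre x)
    _ = 2 * exp (a * G) * ∫ x, cosh (a * (P (expCircle x)).re) := integral_const_mul _ _
    _ ≤ 2 * exp (a * G) * (cos (a * A))⁻¹ := by gcongr

end ExponentialIntegrability

section Dilation

variable {ζ : ℂ} {g : ℂ → ℝ}

lemma norm_mul_lt_one_of_mem_ball {z : ℂ} (hz : z ∈ ball (0 : ℂ) ‖ζ‖⁻¹) : ‖ζ * z‖ < 1 := by
  rcases eq_or_ne ζ 0 with rfl | hζ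
  · simp
  · have hpos : 0 < ‖ζ‖ := norm_pos_iff.2 hζ
    rw [norm_mul, ← mul_inv_cancel₀ hpos.ne']
    exact mul_lt_mul_of_pos_left (mem_ball_zero_iff.1 hz) hpos

lemma differentiableOn_herglotzIntegral_mul (hg : Integrable fun x => g (expCircle x)) (ζ : ℂ) :
    DifferentiableOn ℂ (fun z => herglotzIntegral g (ζ * z)) (ball 0 ‖ζ‖⁻¹) := fun z hz =>
  ((hasDerivAt_herglotzIntegral hg (norm_mul_lt_one_of_mem_ball hz)).differentiableAt.comp z
    (differentiableAt_id.const_mul ζ)).differentiableWithinAt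

lemma re_herglotzIntegral_mul_expCircle (hg : Integrable fun x => g (expCircle x)) (hζ : ‖ζ‖ < 1)
    (x : UnitAddCircle) :
    (herglotzIntegral g (ζ * expCircle x)).re = poissonAverage ζ (fun y => g (expCircle y)) x := by
  rw [re_herglotzIntegral hg (by rwa [norm_mul, norm_expCircle, mul_one])]
  simp only [poissonKernel_mul_expCircle]
  rfl

lemma re_herglotzIntegral_le (hg : Integrable fun x => g (expCircle x))
    (hg0 : ∀ x, 0 ≤ g (expCircle x)) (hζ : ‖ζ‖ < 1) :
    (herglotzIntegral g ζ).re ≤ (1 + ‖ζ‖) / (1 - ‖ζ‖) * ∫ x, g (expCircle x) := by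
  rw [re_herglotzIntegral hg hζ, ← integral_const_mul]
  exact integral_mono_of_nonneg
    (.of_forall fun x => mul_nonneg (poissonKernel_expCircle_nonneg hζ x) (hg0 x))
    (hg.const_mul _)
    (.of_forall fun x => mul_le_mul_of_nonneg_right (poissonKernel_expCircle_le hζ x) (hg0 x))

end Dilation

namespace IsNonnegSuperharmonicOn

variable {w : ℂ → ℝ≥0∞} {R ρ : ℝ} {ζ : ℂ}

lemma measurable_comp_expCircle (hw : IsNonnegSuperharmonicOn w (ball 0 R)) (hR : 1 < R) :
    Measurable fun x => w (expCircle x) :=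
  (hw.lowerSemicontinuous_comp continuous_expCircle (expCircle_mem_ball hR)).measurable

lemma lintegral_comp_expCircle_le (hw : IsNonnegSuperharmonicOn w (ball 0 R)) (hR : 1 < R) :
    ∫⁻ x, w (expCircle x) ≤ w 0 := by
  simpa using hw.lintegral_le 0 1 one_pos (closedBall_subset_ball hR)

lemma integrable_toReal_comp_expCircle (hw : IsNonnegSuperharmonicOn w (ball 0 R)) (hR : 1 < R)
    (h0 : w 0 ≠ ∞) : Integrable fun x => (w (expCircle x)).toReal :=
  integrable_toReal_of_lintegral_ne_top (hw.measurable_comp_expCircle hR).aemeasurable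
    (ne_top_of_le_ne_top h0 (hw.lintegral_comp_expCircle_le hR))

lemma ae_comp_expCircle_lt_top (hw : IsNonnegSuperharmonicOn w (ball 0 R)) (hR : 1 < R)
    (h0 : w 0 ≠ ∞) : ∀ᵐ x, w (expCircle x) < ∞ :=
  ae_lt_top (hw.measurable_comp_expCircle hR)
    (ne_top_of_le_ne_top h0 (hw.lintegral_comp_expCircle_le hR))

lemma integral_toReal_comp_expCircle_le (hw : IsNonnegSuperharmonicOn w (ball 0 R)) (hR : 1 < R)
    (h0 : w 0 ≠ ∞) : ∫ x, (w (expCircle x)).toReal ≤ (w 0).toReal := by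
  rw [integral_toReal (hw.measurable_comp_expCircle hR).aemeasurable
    (hw.ae_comp_expCircle_lt_top hR h0)]
  exact ENNReal.toReal_mono h0 (hw.lintegral_comp_expCircle_le hR)

lemma rotationAverage_poissonKernel (hw : IsNonnegSuperharmonicOn w (ball 0 R)) (hR : 1 < R)
    (h0 : w 0 ≠ ∞) (hζ : ‖ζ‖ < 1) (x : UnitAddCircle) :
    rotationAverage w (fun y => ENNReal.ofReal (poissonKernel 0 ζ (expCircle y))) (expCircle x) =
      ENNReal.ofReal (poissonAverage ζ (fun y => (w (expCircle y)).toReal) x) := by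
  have hP (y) := poissonKernel_expCircle_nonneg hζ (y - x)
  rw [poissonAverage, ofReal_integral_eq_lintegral_ofReal
    (integrable_poissonKernel_smul hζ (hw.integrable_toReal_comp_expCircle hR h0) x)
    (.of_forall fun y => mul_nonneg (hP y) ENNReal.toReal_nonneg), rotationAverage,
    ← lintegral_sub_right_eq_self (fun y => w (expCircle x * expCircle y) *
      ENNReal.ofReal (poissonKernel 0 ζ (expCircle y))) x]
  refine lintegral_congr_ae ?_
  filter_upwards [hw.ae_comp_expCircle_lt_top hR h0] with y hy
  rw [← expCircle_add, add_sub_cancel, mul_comm, smul_eq_mul, ENNReal.ofReal_mul (hP y),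
    ENNReal.ofReal_toReal hy.ne]

lemma neg_le_re_mul_deriv_herglotzIntegral (hw : IsNonnegSuperharmonicOn w (ball 0 R))
    (hρ : 1 < ρ) (hρR : ρ < R) (h0 : w 0 ≠ ∞) (hζ0 : ζ ≠ 0) (hζ : ‖ζ‖ < 1) {z : ℂ}
    (hz : ‖z‖ = 1) :
    -((ρ + 1) / (ρ - 1) * (w 0).toReal / log ρ) / 2 ≤
      (z * deriv (fun z => herglotzIntegral (fun z => (w z).toReal) (ζ * z)) z).re := by
  have hR : 1 < R := hρ.trans hρR
  set g : ℂ → ℝ := fun z => (w z).toReal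
  have hg : Integrable fun x => g (expCircle x) := hw.integrable_toReal_comp_expCircle hR h0
  have hρ_inv : ρ⁻¹ < 1 := inv_lt_one_of_one_lt₀ hρ
  refine (isNonnegSuperharmonicOn_rotationAverage hw (ENNReal.continuous_ofReal.comp
      (continuous_poissonKernel_expCircle hζ)).measurable).neg_le_re_mul_deriv hρ hρR
    ((one_lt_inv₀ (norm_pos_iff.2 hζ0)).2 hζ) (differentiableOn_herglotzIntegral_mul hg ζ)
    (fun z hz => ?_) (fun z hz => ?_) (fun z hz => ?_) hz
  · obtain ⟨x, rfl⟩ := exists_expCircle_eq hz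
    rw [re_herglotzIntegral_mul_expCircle hg hζ]
    exact hw.rotationAverage_poissonKernel hR h0 hζ x
  · obtain ⟨x, rfl⟩ := exists_expCircle_eq hz
    rw [re_herglotzIntegral_mul_expCircle hg hζ]
    exact poissonAverage_nonneg hζ (fun _ => ENNReal.toReal_nonneg) x
  · have hnorm : ‖ζ * z‖ ≤ ρ⁻¹ := by
      rw [norm_mul, hz]
      exact mul_le_of_le_one_left (by positivity) hζ.le
    calc (herglotzIntegral g (ζ * z)).re
        ≤ (1 + ‖ζ * z‖) / (1 - ‖ζ * z‖) * ∫ x, g (expCircle x) :=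
          re_herglotzIntegral_le hg (fun _ => ENNReal.toReal_nonneg) (hnorm.trans_lt hρ_inv)
      _ ≤ (1 + ρ⁻¹) / (1 - ρ⁻¹) * (w 0).toReal := by
          have : 0 < 1 - ρ⁻¹ := sub_pos.2 hρ_inv
          gcongr
          exact hw.integral_toReal_comp_expCircle_le hR h0
      _ = (ρ + 1) / (ρ - 1) * (w 0).toReal := by
          congr 1
          have hne : ρ - 1 ≠ 0 := (sub_pos.2 hρ).ne'
          field_simp

end IsNonnegSuperharmonicOn

section SplitBoundaryValues

variable {q : ℂ → ℝ} {m : UnitAddCircle → ℝ} {ε₀ ε₁ r δ : ℝ} {ζ : ℂ}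

lemma norm_herglotzIntegral_deriv_kernel_mul_le (hζ : ‖ζ‖ < 1) {a b : ℝ} (hb : 0 ≤ b)
    (ha : |a| ≤ b + ε₀) (x : UnitAddCircle) :
    ‖2 * expCircle x / (expCircle x - ζ) ^ 2 * (a : ℂ)‖ ≤
      2 * ε₀ / (1 - ‖ζ‖ ^ 2) * poissonKernel 0 ζ (expCircle x) + 2 / (1 - ‖ζ‖) ^ 2 * b := by
  have hpos : 0 < 1 - ‖ζ‖ := sub_pos.2 hζ
  have hpos_sq : 0 < 1 - ‖ζ‖ ^ 2 := by nlinarith [norm_nonneg ζ]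
  have hdist : 1 - ‖ζ‖ ≤ ‖expCircle x - ζ‖ := by
    simpa only [norm_expCircle] using norm_sub_norm_le (expCircle x) ζ
  have hdist_pos : 0 < ‖expCircle x - ζ‖ := hpos.trans_le hdist
  rw [norm_mul, norm_div, norm_mul, norm_expCircle, norm_pow, Complex.norm_real, norm_eq_abs,
    poissonKernel_expCircle, Complex.norm_two, mul_one]
  calc 2 / ‖expCircle x - ζ‖ ^ 2 * |a|
      ≤ 2 / ‖expCircle x - ζ‖ ^ 2 * (b + ε₀) := by gcongr
    _ = 2 * ε₀ / (1 - ‖ζ‖ ^ 2) * ((1 - ‖ζ‖ ^ 2) / ‖expCircle x - ζ‖ ^ 2) +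
        2 / ‖expCircle x - ζ‖ ^ 2 * b := by
      field_simp
      ring
    _ ≤ _ := by gcongr

lemma norm_mul_deriv_herglotzIntegral_le (hq : Integrable fun x => q (expCircle x))
    (hm : Integrable m) (hm0 : ∀ x, 0 ≤ m x) (hqm : ∀ᵐ x, |q (expCircle x)| ≤ m x + ε₀)
    (hmε : ∫ x, m x ≤ ε₁) (hζ : ‖ζ‖ < 1) :
    ‖ζ * deriv (herglotzIntegral q) ζ‖ ≤
      2 * (ε₀ * (‖ζ‖ / (1 - ‖ζ‖ ^ 2)) + ε₁ * (‖ζ‖ / (1 - ‖ζ‖) ^ 2)) := by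
  have hkernel : Integrable fun x =>
      2 * ε₀ / (1 - ‖ζ‖ ^ 2) * poissonKernel 0 ζ (expCircle x) :=
    (integrable_of_continuous (continuous_poissonKernel_expCircle hζ)).const_mul _
  have hmass : Integrable fun x => 2 / (1 - ‖ζ‖) ^ 2 * m x := hm.const_mul _
  rw [(hasDerivAt_herglotzIntegral hq hζ).deriv, norm_mul]
  calc ‖ζ‖ * ‖∫ x, 2 * expCircle x / (expCircle x - ζ) ^ 2 * (q (expCircle x) : ℂ)‖
      ≤ ‖ζ‖ * ∫ x, (2 * ε₀ / (1 - ‖ζ‖ ^ 2) * poissonKernel 0 ζ (expCircle x) +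
          2 / (1 - ‖ζ‖) ^ 2 * m x) := by
        gcongr
        refine norm_integral_le_of_norm_le (hkernel.add hmass) ?_
        filter_upwards [hqm] with x hx
        exact norm_herglotzIntegral_deriv_kernel_mul_le hζ (hm0 x) hx x
    _ = ‖ζ‖ * (2 * ε₀ / (1 - ‖ζ‖ ^ 2) + 2 / (1 - ‖ζ‖) ^ 2 * ∫ x, m x) := by
        rw [integral_add hkernel hmass, integral_const_mul, integral_const_mul,
          integral_poissonKernel hζ, mul_one]
    _ ≤ ‖ζ‖ * (2 * ε₀ / (1 - ‖ζ‖ ^ 2) + 2 / (1 - ‖ζ‖) ^ 2 * ε₁) := by gcongr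
    _ = _ := by ring

lemma neg_re_mul_deriv_herglotzIntegral_mul_le (hq : Integrable fun x => q (expCircle x))
    (hm : Integrable m) (hm0 : ∀ x, 0 ≤ m x) (hqm : ∀ᵐ x, |q (expCircle x)| ≤ m x + ε₀)
    (hmε : ∫ x, m x ≤ ε₁) (hε₀ : 0 ≤ ε₀) (hζ : ‖ζ‖ ≤ 1) (hr : r < 1) {z : ℂ} (hz : ‖z‖ = r) :
    -(2 * π * (z * deriv (fun z => herglotzIntegral q (ζ * z)) z).re) ≤
      4 * π * (ε₀ * (r / (1 - r ^ 2)) + ε₁ * (r / (1 - r) ^ 2)) := by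
  have hr0 : 0 ≤ r := hz ▸ norm_nonneg z
  have hε₁ : 0 ≤ ε₁ := (integral_nonneg hm0).trans hmε
  have hle : ‖ζ * z‖ ≤ r := by
    rw [norm_mul, hz]
    exact mul_le_of_le_one_left hr0 hζ
  have hnorm := norm_mul_deriv_herglotzIntegral_le hq hm hm0 hqm hmε (hle.trans_lt hr)
  have hre : -(ζ * z * deriv (herglotzIntegral q) (ζ * z)).re ≤
      2 * (ε₀ * (r / (1 - r ^ 2)) + ε₁ * (r / (1 - r) ^ 2)) := by
    refine ((neg_le_abs _).trans (Complex.abs_re_le_norm _)).trans (hnorm.trans ?_)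
    have hpos : 0 < 1 - r := sub_pos.2 hr
    have hpos_sq : 0 < 1 - r ^ 2 := by nlinarith only [hpos, hr0]
    gcongr
  rw [deriv_comp_mul_left, smul_eq_mul, ← mul_assoc, mul_comm z]
  linarith [mul_le_mul_of_nonneg_left hre two_pi_pos.le]

lemma abs_poissonAverage_le {q : UnitAddCircle → ℝ} (hq : Integrable q) (hm : Integrable m)
    (hqm : ∀ᵐ x, |q x| ≤ m x + ε₀) (hζ : ‖ζ‖ < 1) (x : UnitAddCircle) :
    |poissonAverage ζ q x| ≤ poissonAverage ζ m x + ε₀ := by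
  have hdiff : poissonAverage ζ (fun y => |q y| - m y) x ≤ ε₀ := by
    refine poissonAverage_le_of_le hζ (hq.abs.sub hm) ?_ x
    filter_upwards [hqm] with y hy
    exact sub_le_iff_le_add'.2 hy
  rw [poissonAverage_sub hζ hq.abs hm] at hdiff
  exact (norm_poissonAverage_le hζ q x).trans (sub_le_iff_le_add'.1 hdiff)

lemma abs_arcAverage_re_herglotzIntegral_mul_le (hq : Integrable fun x => q (expCircle x))
    (hm : Integrable m) (hm0 : ∀ x, 0 ≤ m x) (hqm : ∀ᵐ x, |q (expCircle x)| ≤ m x + ε₀)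
    (hmε : ∫ x, m x ≤ ε₁) (hζ : ‖ζ‖ < 1) (hδ : 0 < δ) (hδ1 : 2 * δ ≤ 1) (x : UnitAddCircle) :
    |arcAverage (fun z => (herglotzIntegral q (ζ * z)).re) δ (expCircle x)| ≤
      ε₀ + ε₁ / (2 * δ) := by
  have hcont : Continuous fun y => poissonAverage ζ m (x + y) :=
    (continuous_poissonAverage hζ hm).comp (continuous_const_add x)
  have hcont_coe : Continuous fun t : ℝ => poissonAverage ζ m (x + t) :=
    hcont.comp (AddCircle.continuous_mk' 1)
  have hbound : Continuous fun t : ℝ => poissonAverage ζ m (x + t) + ε₀ :=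
    hcont_coe.add continuous_const
  simp only [arcAverage_expCircle, re_herglotzIntegral_mul_expCircle hq hζ, smul_eq_mul]
  rw [abs_mul, abs_of_pos (by positivity), inv_mul_le_iff₀ (by positivity)]
  calc |∫ t in -δ..δ, poissonAverage ζ (fun y => q (expCircle y)) (x + t)|
      ≤ ∫ t in -δ..δ, (poissonAverage ζ m (x + t) + ε₀) :=
        (norm_eq_abs _).symm.trans_le (intervalIntegral.norm_integral_le_of_norm_le (by linarith)
          (.of_forall fun t _ => (norm_eq_abs _).trans_le (abs_poissonAverage_le hq hm hqm hζ _))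
          (hbound.intervalIntegrable _ _))
    _ = (∫ t in -δ..δ, poissonAverage ζ m (x + t)) + 2 * δ * ε₀ := by
        rw [intervalIntegral.integral_add (hcont_coe.intervalIntegrable _ _)
          intervalIntegrable_const, intervalIntegral.integral_const, smul_eq_mul]
        ring
    _ ≤ (∫ y, poissonAverage ζ m (x + y)) + 2 * δ * ε₀ := by
        gcongr
        exact intervalIntegral_coe_le_integral hcont (fun y => poissonAverage_nonneg hζ hm0 _)
          (by linarith) (by linarith)
    _ = (∫ y, m y) + 2 * δ * ε₀ := by
        rw [integral_add_left_eq_self (poissonAverage ζ m) x, integral_poissonAverage hζ hm]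
    _ ≤ ε₁ + 2 * δ * ε₀ := by gcongr
    _ = 2 * δ * (ε₀ + ε₁ / (2 * δ)) := by
        field_simp
        ring

end SplitBoundaryValues

lemma lintegral_exp_abs_le_of_poissonAverage {q : UnitAddCircle → ℝ} (hq : Integrable q) {a C : ℝ}
    (hC : ∀ s ∈ Ioo (0 : ℝ) 1, ∫ x, exp (a * |poissonAverage s q x|) ≤ C) :
    ∫⁻ x, ENNReal.ofReal (exp (a * |q x|)) ≤ ENNReal.ofReal C := by
  obtain ⟨s, hs, hlim⟩ := exists_seq_tendsto_poissonAverage hq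
  have hexp : Continuous fun t : ℝ => exp (a * |t|) := by fun_prop
  have hexp_ofReal : Continuous fun t : ℝ => ENNReal.ofReal (exp (a * |t|)) :=
    ENNReal.continuous_ofReal.comp hexp
  have hcont (n) : Continuous (poissonAverage (s n) q) :=
    continuous_poissonAverage (by rw [Complex.norm_of_nonneg (hs n).1.le]; exact (hs n).2) hq
  calc ∫⁻ x, ENNReal.ofReal (exp (a * |q x|))
      = ∫⁻ x, liminf (fun n => ENNReal.ofReal (exp (a * |poissonAverage (s n) q x|))) atTop := by
        refine lintegral_congr_ae ?_
        filter_upwards [hlim] with x hx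
        exact ((hexp_ofReal.tendsto _).comp hx).liminf_eq.symm
    _ ≤ liminf (fun n => ∫⁻ x, ENNReal.ofReal (exp (a * |poissonAverage (s n) q x|))) atTop :=
        lintegral_liminf_le fun n => (hexp_ofReal.comp (hcont n)).measurable
    _ ≤ ENNReal.ofReal C := by
        refine liminf_le_of_frequently_le' (.of_forall fun n => ?_)
        have hint : Integrable fun x => exp (a * |poissonAverage (s n) q x|) :=
          integrable_of_continuous (hexp.comp (hcont n))
        rw [← ofReal_integral_eq_lintegral_ofReal hint (.of_forall fun x => (exp_pos _).le)]
        exact ENNReal.ofReal_le_ofReal (hC _ (hs n))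

namespace IsNonnegSuperharmonicOn

variable {w : ℂ → ℝ≥0∞} {R ρ b κ : ℝ} {ζ : ℂ}

lemma re_mul_deriv_herglotzIntegral_sub_le (hw : IsNonnegSuperharmonicOn w (ball 0 R))
    (hρ : 1 < ρ) (hρR : ρ < R) (h0 : w 0 ≠ ∞)
    (hκ : π * ((ρ + 1) / (ρ - 1) * (w 0).toReal / log ρ) ≤ κ) (hζ0 : ζ ≠ 0) (hζ : ‖ζ‖ < 1) {z : ℂ}
    (hz : ‖z‖ = 1) :
    2 * π * (z * deriv (fun z => herglotzIntegral (fun z => b - (w z).toReal) (ζ * z)) z).re ≤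
      κ := by
  have hg := hw.integrable_toReal_comp_expCircle (hρ.trans hρR) h0
  have hmem : ζ * z ∈ ball (0 : ℂ) 1 := by
    rw [mem_ball_zero_iff, norm_mul, hz, mul_one]
    exact hζ
  have hderiv : deriv (herglotzIntegral fun z => b - (w z).toReal) (ζ * z) =
      -deriv (herglotzIntegral fun z => (w z).toReal) (ζ * z) := by
    rw [← deriv_const_sub (b : ℂ)]
    refine EventuallyEq.deriv_eq ?_
    filter_upwards [isOpen_ball.mem_nhds hmem] with ξ hξ
    exact herglotzIntegral_const_sub (g := fun z => (w z).toReal) hg b (mem_ball_zero_iff.1 hξ)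
  have hlower := hw.neg_le_re_mul_deriv_herglotzIntegral hρ hρR h0 hζ0 hζ hz
  rw [deriv_comp_mul_left] at hlower ⊢
  rw [hderiv, smul_neg, mul_neg, Complex.neg_re]
  refine le_trans ?_ hκ
  linarith [mul_le_mul_of_nonneg_left hlower two_pi_pos.le]

lemma lintegral_exp_abs_sub_le (hw : IsNonnegSuperharmonicOn w (ball 0 R)) (hρ : 1 < ρ)
    (hρR : ρ < R) (h0 : w 0 ≠ ∞) {m : UnitAddCircle → ℝ} {ε₀ ε₁ δ r a A : ℝ} (hm : Integrable m)
    (hm0 : ∀ x, 0 ≤ m x) (hqm : ∀ᵐ x, |b - (w (expCircle x)).toReal| ≤ m x + ε₀)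
    (hmε : ∫ x, m x ≤ ε₁) (hε₀ : 0 ≤ ε₀)
    (hκ : π * ((ρ + 1) / (ρ - 1) * (w 0).toReal / log ρ) ≤ κ) (hδ : 0 < δ) (hr : 1 - r = π * δ)
    (hr0 : 0 ≤ r)
    (hA : (1 - r) / (1 + r) *
      (κ + 4 * π * (ε₀ * (r / (1 - r ^ 2)) + ε₁ * (r / (1 - r) ^ 2))) ≤ A)
    (ha : 0 ≤ a) (haA : a * A < π / 2) :
    ∫⁻ x, ENNReal.ofReal (exp (a * |b - (w (expCircle x)).toReal|)) ≤
      ENNReal.ofReal (2 * exp (a * (ε₀ + ε₁ / (2 * δ))) * (cos (a * A))⁻¹) := by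
  set q : ℂ → ℝ := fun z => b - (w z).toReal
  have hq : Integrable fun x => q (expCircle x) :=
    (integrable_const b).sub (hw.integrable_toReal_comp_expCircle (hρ.trans hρR) h0)
  have hr1 : r < 1 := by nlinarith [pi_pos]
  refine lintegral_exp_abs_le_of_poissonAverage hq fun s hs => ?_
  have hs0 : (s : ℂ) ≠ 0 := Complex.ofReal_ne_zero.2 hs.1.ne'
  have hs1 : ‖(s : ℂ)‖ < 1 := by rw [Complex.norm_of_nonneg hs.1.le]; exact hs.2
  have hσ : 1 < ‖(s : ℂ)‖⁻¹ := (one_lt_inv₀ (norm_pos_iff.2 hs0)).2 hs1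
  have hdiff := differentiableOn_herglotzIntegral_mul (g := q) hq s
  simp only [← re_herglotzIntegral_mul_expCircle (g := q) hq hs1]
  exact integral_exp_abs_re_le hσ hdiff hδ.ne'
    (fun x => (abs_im_sub_arcAverage_le hσ hdiff hδ hr hr0
      (fun z hz => hw.re_mul_deriv_herglotzIntegral_sub_le hρ hρR h0 hκ hs0 hs1 hz)
      (fun z hz => neg_re_mul_deriv_herglotzIntegral_mul_le (q := q) hq hm hm0 hqm hmε hε₀ hs1.le
        hr1 hz) x).trans hA)
    (abs_arcAverage_re_herglotzIntegral_mul_le (q := q) hq hm hm0 hqm hmε hs1 hδ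
      (by nlinarith [pi_gt_three])) ha haA

end IsNonnegSuperharmonicOn

section Constants

variable {R R₁ R₂ : ℝ}

lemma log_div_pos (hR₁ : 0 < R₁) (hR : R₁ < R) : 0 < log (R / R₁) :=
  log_pos ((one_lt_div hR₁).2 hR)

lemma half_le_constB0 (hR₂ : 0 ≤ R₂) (hR₁ : R₂ < R₁) (hR₁_one : 1 ≤ R₁) (hR : R₁ < R) :
    1 / 2 ≤ constB0 R R₁ R₂ := by
  have hR₁0 : 0 < R₁ := by linarith
  have hR0 : 0 < R := by linarith
  have hlog : 0 < log (R / R₁) := log_div_pos hR₁0 hR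
  have hlogR : log (R / R₁) ≤ log R :=
    log_le_log (div_pos hR0 hR₁0) (div_le_self hR0.le hR₁_one)
  have hcases : log (R / R₁) ≤
      if R ^ 2 - R₁ ^ 2 > R then log R else log (R ^ 2 / (R ^ 2 - R₁ ^ 2)) := by
    split_ifs with h
    · exact hlogR
    · refine hlogR.trans (log_le_log hR0 ?_)
      rw [le_div_iff₀ (by nlinarith), sq R]
      exact mul_le_mul_of_nonneg_left (by linarith) hR0.le
  have hratio : 1 ≤ (R₁ + R₂) / (R₁ - R₂) := by
    rw [one_le_div (by linarith)]
    linarith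
  calc (1 : ℝ) / 2 = 1 / (2 * log (R / R₁)) * 1 * log (R / R₁) := by field_simp
    _ ≤ constB0 R R₁ R₂ := by
      rw [constB0]
      gcongr

lemma constB1_nonneg (hR₂ : 1 < R₂) (hR₁ : R₂ < R₁) (hR : R₁ < R) : 0 ≤ constB1 R R₁ R₂ := by
  have hB₀ := half_le_constB0 (by linarith) hR₁ (by linarith) hR
  exact mul_nonneg (by linarith) (div_nonneg (by linarith) (by nlinarith))

section Quartic

variable {r s : ℝ}

lemma sixteen_mul_sq_le_of_sq_eq (hr : 0 ≤ r) (hs0 : 0 ≤ s) (hs : s ^ 2 = r ^ 4 + 34 * r ^ 2 + 1) :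
    16 * r ^ 2 ≤ (s - 1 - r ^ 2) * (r + 1) ^ 2 := by
  have hlower : 1 + r ^ 2 ≤ s := by
    rw [← pow_le_pow_iff_left₀ (by positivity) hs0 two_ne_zero, hs]
    nlinarith
  have hupper : s ≤ r ^ 2 + 4 * r + 1 := by
    rw [← pow_le_pow_iff_left₀ hs0 (by positivity) two_ne_zero, hs]
    nlinarith [mul_nonneg hr (sq_nonneg (r - 1))]
  have hprod : (s - 1 - r ^ 2) * (s + 1 + r ^ 2) = 32 * r ^ 2 := by linear_combination hs
  linarith [mul_le_mul_of_nonneg_left hupper (by linarith : 0 ≤ s - 1 - r ^ 2), hprod]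

lemma lt_of_sq_eq (hr : 1 < r) (hs : s ^ 2 = r ^ 4 + 34 * r ^ 2 + 1) : s < 3 * r ^ 2 + 3 := by
  refine lt_of_pow_lt_pow_left₀ 2 (by positivity) ?_
  rw [hs]
  nlinarith [pow_pos (by nlinarith : 0 < r ^ 2 - 1) 2]

lemma six_mul_le_of_sq_eq (hs0 : 0 ≤ s) (hs : s ^ 2 = r ^ 4 + 34 * r ^ 2 + 1) : 6 * r ≤ s := by
  refine le_of_sq_le_sq ?_ hs0
  nlinarith [sq_nonneg (r ^ 2 - 1)]

lemma mul_gap_sq_le_sqrt (hr : 1 < r) (hs0 : 0 ≤ s) (hs : s ^ 2 = r ^ 4 + 34 * r ^ 2 + 1) :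
    r * (3 * r ^ 2 + 3 - s) ^ 2 ≤
      √(16 * r ^ 2 - (s - 1 - r ^ 2) ^ 2) * (2 * (r ^ 2 - 1) * (r - 1) ^ 2) := by
  have hr1 : 0 < r - 1 := sub_pos.2 hr
  have hr2 : 0 < r ^ 2 - 1 := by nlinarith only [hr1]
  have hD0 : 0 < 3 * r ^ 2 + 3 - s := sub_pos.2 (lt_of_sq_eq hr hs)
  have hD : 3 * r ^ 2 + 3 - s ≤ 3 * (r - 1) ^ 2 := by linarith [six_mul_le_of_sq_eq hs0 hs]
  have hu := sixteen_mul_sq_le_of_sq_eq (by linarith) hs0 hs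
  have hradicand : 16 * r ^ 2 - (s - 1 - r ^ 2) ^ 2 =
      (s - 1 - r ^ 2) * (3 * r ^ 2 + 3 - s) / 2 := by linear_combination (-1 / 2 : ℝ) * hs
  rw [hradicand, ← div_le_iff₀ (by positivity)]
  generalize 3 * r ^ 2 + 3 - s = D at *
  generalize s - 1 - r ^ 2 = u at *
  refine le_sqrt_of_sq_le ?_
  rw [div_pow, div_le_iff₀ (by positivity)]
  calc (r * D ^ 2) ^ 2 = D * (r ^ 2 * D ^ 3) := by ring
    _ ≤ D * (r ^ 2 * (3 * (r - 1) ^ 2) ^ 3) := by gcongr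
    _ = D * (27 / 16 * (r - 1) ^ 6 * (16 * r ^ 2)) := by ring
    _ ≤ D * (2 * (r - 1) ^ 6 * (u * (r + 1) ^ 2)) := by gcongr; norm_num
    _ = _ := by ring

end Quartic

lemma le_constB2 (hR₂ : 1 < R₂) (hR₁ : R₂ < R₁) (hR : R₁ < R) :
    4 * π * (R₂ / (R₂ - 1) ^ 2) ≤ constB2 R R₁ R₂ := by
  have hs : √(R₂ ^ 4 + 34 * R₂ ^ 2 + 1) ^ 2 = R₂ ^ 4 + 34 * R₂ ^ 2 + 1 := sq_sqrt (by positivity)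
  have hD : 0 < 3 * R₂ ^ 2 + 3 - √(R₂ ^ 4 + 34 * R₂ ^ 2 + 1) := sub_pos.2 (lt_of_sq_eq hR₂ hs)
  have hgap := mul_gap_sq_le_sqrt hR₂ (sqrt_nonneg _) hs
  have : 0 < R₂ - 1 := sub_pos.2 hR₂
  calc 4 * π * (R₂ / (R₂ - 1) ^ 2) = 1 / 2 * (8 * π * R₂ / (R₂ - 1) ^ 2) := by ring
    _ ≤ constB2 R R₁ R₂ := by
      rw [constB2]
      have hB₀ := half_le_constB0 (by linarith) hR₁ (by linarith) hR
      refine mul_le_mul hB₀ ?_ (by positivity) (by linarith)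
      rw [div_le_div_iff₀ (by positivity) (by positivity)]
      linarith [mul_le_mul_of_nonneg_left hgap (by positivity : 0 ≤ 8 * π)]

lemma constB3_nonneg : 0 ≤ constB3 R R₁ R₂ := sqrt_nonneg _

lemma constB3_sq (hR₂ : 1 < R₂) (hR₁ : R₂ < R₁) (hR : R₁ < R) :
    constB3 R R₁ R₂ ^ 2 = 5 * constB2 R R₁ R₂ + 10 * π / log (R / R₁) := by
  have hlog := log_div_pos (by linarith) hR
  have hB₂ : 0 ≤ constB2 R R₁ R₂ := le_trans (by positivity) (le_constB2 hR₂ hR₁ hR)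
  exact sq_sqrt (by positivity)

lemma inv_mul_log_le {ρ : ℝ} (hρ : 1 < ρ) : ((ρ - 1) * log ρ)⁻¹ ≤ ρ / (ρ - 1) ^ 2 := by
  have hρ0 : 0 < ρ := by linarith
  have hρ1 : 0 < ρ - 1 := sub_pos.2 hρ
  have hlog : ρ - 1 ≤ ρ * log ρ := by
    calc ρ - 1 = ρ * (1 - ρ⁻¹) := by field_simp
      _ ≤ ρ * log ρ := by
        gcongr
        exact one_sub_inv_le_log_of_pos hρ0
  rw [inv_le_comm₀ (mul_pos hρ1 (log_pos hρ)) (by positivity), inv_div, div_le_iff₀ hρ0]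
  nlinarith

lemma div_sub_one_sq_anti {r ρ : ℝ} (hr : 1 < r) (hrρ : r ≤ ρ) :
    ρ / (ρ - 1) ^ 2 ≤ r / (r - 1) ^ 2 := by
  rw [div_le_div_iff₀ (pow_pos (by linarith) 2) (pow_pos (by linarith) 2)]
  nlinarith [mul_nonneg (sub_nonneg.2 hrρ) (by nlinarith : 0 ≤ ρ * r - 1)]

lemma exists_radius_le_constB3_sq (hR₂ : 1 < R₂) (hR₁ : R₂ < R₁) (hR : R₁ < R) :
    ∃ ρ, 1 < ρ ∧ ρ < R ∧ π * ((ρ + 1) / (ρ - 1) / log ρ) ≤ constB3 R R₁ R₂ ^ 2 / 10 := by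
  have hR₁0 : 0 < R₁ := by linarith
  have hlog : 0 < log (R / R₁) := log_div_pos hR₁0 hR
  obtain ⟨ρ, hρR₁, hρR, hdiv⟩ : ∃ ρ, R₁ ≤ ρ ∧ ρ < R ∧ R / R₁ ≤ ρ :=
    ⟨max R₁ (R / R₁), le_max_left _ _, max_lt hR (div_lt_self (by linarith) (by linarith)),
      le_max_right _ _⟩
  have hρ : 1 < ρ := by linarith
  have hρ1 : ρ - 1 ≠ 0 := (sub_pos.2 hρ).ne'
  have hlogρ : log (R / R₁) ≤ log ρ := log_le_log (div_pos (by linarith) hR₁0) hdiv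
  have hlogρ0 : log ρ ≠ 0 := (log_pos hρ).ne'
  refine ⟨ρ, hρ, hρR, ?_⟩
  calc π * ((ρ + 1) / (ρ - 1) / log ρ) = π / log ρ + 2 * π * ((ρ - 1) * log ρ)⁻¹ := by
        field_simp
        ring
    _ ≤ π / log (R / R₁) + 2 * π * (R₂ / (R₂ - 1) ^ 2) := by
        gcongr
        exact (inv_mul_log_le hρ).trans (div_sub_one_sq_anti hR₂ (by linarith))
    _ ≤ π / log (R / R₁) + constB2 R R₁ R₂ / 2 := by linarith [le_constB2 hR₂ hR₁ hR]
    _ = constB3 R R₁ R₂ ^ 2 / 10 := by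
        rw [constB3_sq hR₂ hR₁ hR]
        ring

lemma exp_le_mul_exp : exp (π / 18) ≤ 1.1 * exp (π / 4 * (17 / 144)) := by
  have hsplit : exp (π / 18) * exp (-(π * (15 / 576))) = exp (π / 4 * (17 / 144)) := by
    rw [← exp_add]
    congr 1
    ring
  have hfactor : 1 ≤ 1.1 * exp (-(π * (15 / 576))) := by
    linarith [add_one_le_exp (-(π * (15 / 576))), pi_lt_d2]
  calc exp (π / 18) ≤ exp (π / 18) * (1.1 * exp (-(π * (15 / 576)))) :=
        le_mul_of_one_le_right (exp_pos _).le hfactor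
    _ = 1.1 * exp (π / 4 * (17 / 144)) := by
        rw [← hsplit]
        ring

lemma two_mul_exp_mul_inv_cos_le :
    2 * exp (π / 18) * (cos (3 * π / 16))⁻¹ ≤ 2 * √2 * exp (π / 4 * (17 / 144)) := by
  have hcos : 0.82 ≤ cos (3 * π / 16) := by
    nlinarith [one_sub_sq_div_two_le_cos (x := 3 * π / 16), pi_lt_d4, pi_pos]
  have hsqrt : 1.4 ≤ √2 := le_sqrt_of_sq_le (by norm_num)
  rw [← div_eq_mul_inv, div_le_iff₀ (by linarith)]
  calc 2 * exp (π / 18) ≤ 2 * (1.1 * exp (π / 4 * (17 / 144))) := by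
        gcongr
        exact exp_le_mul_exp
    _ ≤ 2 * 1.4 * exp (π / 4 * (17 / 144)) * 0.82 := by linarith [exp_pos (π / 4 * (17 / 144))]
    _ ≤ 2 * √2 * exp (π / 4 * (17 / 144)) * cos (3 * π / 16) := by gcongr

lemma pi_mul_le_of_sq_le {δ : ℝ} (hδ : 289 * δ ^ 2 ≤ 10) : π * δ ≤ 0.59 := by
  have hδ_le : δ ≤ 0.1862 := by
    by_contra! h
    nlinarith
  nlinarith [pi_lt_d4, pi_pos]

lemma oscillation_bound_le {κ ε₀ δ r : ℝ} (hκ : 0 ≤ κ) (hε₀ : 0 ≤ ε₀) (hδ : 0 < δ)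
    (hδ_sq : 289 * δ ^ 2 ≤ 10) (hr : 1 - r = π * δ) :
    (1 - r) / (1 + r) *
      (κ + 4 * π * (ε₀ * (r / (1 - r ^ 2)) + κ * δ ^ 2 * (r / (1 - r) ^ 2))) ≤
      3 / 4 * (9 / 2 * ε₀ + 2 * (√10 * (κ * δ))) := by
  have hπδ := pi_mul_le_of_sq_le hδ_sq
  have hπδ0 : 0 < π * δ := by positivity
  have hr0 : 0 < r := by linarith
  have hsqrt : 3.16 ≤ √10 := le_sqrt_of_sq_le (by norm_num)
  have hexpand : (1 - r) / (1 + r) *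
      (κ + 4 * π * (ε₀ * (r / (1 - r ^ 2)) + κ * δ ^ 2 * (r / (1 - r) ^ 2))) =
      κ * δ * ((π + 4 * r) / (1 + r)) + π * ε₀ * (4 * r / (1 + r) ^ 2) := by
    have hfactor : 1 - r ^ 2 = (1 - r) * (1 + r) := by ring
    rw [hfactor, hr]
    field_simp
    ring
  have hL1 : (π + 4 * r) / (1 + r) ≤ 4.74 := by
    rw [div_le_iff₀ (by linarith)]
    nlinarith [pi_lt_d4]
  have hLinfty : 4 * r / (1 + r) ^ 2 ≤ 1 := by
    rw [div_le_one (by positivity)]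
    linarith [sq_nonneg (1 - r)]
  calc _ = κ * δ * ((π + 4 * r) / (1 + r)) + π * ε₀ * (4 * r / (1 + r) ^ 2) := hexpand
    _ ≤ κ * δ * 4.74 + π * ε₀ * 1 := by gcongr
    _ ≤ 3 / 4 * (9 / 2 * ε₀ + 2 * (3.16 * (κ * δ))) := by
        nlinarith [pi_lt_d2, mul_le_mul_of_nonneg_right pi_lt_d2.le hε₀]
    _ ≤ 3 / 4 * (9 / 2 * ε₀ + 2 * (√10 * (κ * δ))) := by gcongr

lemma delta0_mul_sq {B m ε₀ κ δ : ℝ} (hκ : 0 ≤ κ) (hδ : 0 ≤ δ)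
    (hB₃ : constB3 R R₁ R₂ ^ 2 * (B - m) = 10 * κ) :
    delta0 R R₁ R₂ B m ε₀ (κ * δ ^ 2) = 9 / 2 * ε₀ + 2 * (√10 * (κ * δ)) := by
  have hsqrt : constB3 R R₁ R₂ * √(κ * δ ^ 2 * (B - m)) = √10 * (κ * δ) := by
    calc constB3 R R₁ R₂ * √(κ * δ ^ 2 * (B - m))
        = √(constB3 R R₁ R₂ ^ 2) * √(κ * δ ^ 2 * (B - m)) := by
          rw [sqrt_sq constB3_nonneg]
      _ = √(10 * (κ * δ) ^ 2) := by
          rw [← sqrt_mul (sq_nonneg _)]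
          congr 1
          linear_combination κ * δ ^ 2 * hB₃
      _ = √10 * (κ * δ) := by rw [sqrt_mul (by norm_num), sqrt_sq (by positivity)]
  rw [delta0, mul_assoc, hsqrt]

lemma delta0_pos {B m ε₀ ε₁ : ℝ} (hε₀ : 0 < ε₀) : 0 < delta0 R R₁ R₂ B m ε₀ ε₁ := by
  have hB₃ := constB3_nonneg (R := R) (R₁ := R₁) (R₂ := R₂)
  rw [delta0]
  positivity

end Constants

lemma IsNonnegSuperharmonicOn.lintegral_exp_abs_sub_le_of_scale {w : ℂ → ℝ≥0∞}
    {R ρ b κ ε₀ δ : ℝ} {m : UnitAddCircle → ℝ} (hw : IsNonnegSuperharmonicOn w (ball 0 R))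
    (hρ : 1 < ρ) (hρR : ρ < R) (h0 : w 0 ≠ ∞) (hm : Integrable m) (hm0 : ∀ x, 0 ≤ m x)
    (hqm : ∀ᵐ x, |b - (w (expCircle x)).toReal| ≤ m x + ε₀) (hmκ : ∫ x, m x ≤ κ * δ ^ 2)
    (hε₀ : 0 < ε₀) (hκ : π * ((ρ + 1) / (ρ - 1) * (w 0).toReal / log ρ) ≤ κ) (hδ : 0 < δ)
    (hδ_sq : 289 * δ ^ 2 ≤ 10) :
    ∫⁻ x, ENNReal.ofReal (exp (π / 4 * (9 / 2 * ε₀ + 2 * (√10 * (κ * δ)))⁻¹ *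
        |b - (w (expCircle x)).toReal|)) ≤
      ENNReal.ofReal (2 * √2 * exp (π / 4 * (17 / 144))) := by
  have hκ0 : 0 ≤ κ := by
    have := log_pos hρ
    have := sub_pos.2 hρ
    exact le_trans (by positivity) hκ
  set d := 9 / 2 * ε₀ + 2 * (√10 * (κ * δ)) with hd
  have hd0 : 0 < d := by positivity
  have hangle : π / 4 * d⁻¹ * (3 / 4 * d) = 3 * π / 16 := by
    field_simp
    norm_num
  have hcenter : π / 4 * d⁻¹ * (ε₀ + κ * δ ^ 2 / (2 * δ)) ≤ π / 18 := by
    have hsqrt : 3 ≤ √10 := le_sqrt_of_sq_le (by norm_num)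
    calc π / 4 * d⁻¹ * (ε₀ + κ * δ ^ 2 / (2 * δ)) = π / 4 * d⁻¹ * (ε₀ + κ * δ / 2) := by
          field_simp
      _ ≤ π / 4 * d⁻¹ * (2 / 9 * d) := by
          gcongr
          nlinarith [mul_le_mul_of_nonneg_right hsqrt (mul_nonneg hκ0 hδ.le)]
      _ = π / 18 := by
          field_simp
          norm_num
  have hr0 : 0 ≤ 1 - π * δ := by linarith [pi_mul_le_of_sq_le hδ_sq]
  refine (hw.lintegral_exp_abs_sub_le hρ hρR h0 hm hm0 hqm hmκ hε₀.le hκ hδ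
    (sub_sub_cancel 1 (π * δ)) hr0 (oscillation_bound_le hκ0 hε₀.le hδ hδ_sq (sub_sub_cancel 1 _))
    (a := π / 4 * d⁻¹) (by positivity) (by rw [hangle]; linarith [pi_pos])).trans
    (ENNReal.ofReal_le_ofReal (le_trans ?_ two_mul_exp_mul_inv_cos_le))
  rw [hangle]
  have hcos : 0 < cos (3 * π / 16) :=
    cos_pos_of_mem_Ioo ⟨by linarith [pi_pos], by linarith [pi_pos]⟩
  gcongr

lemma superharmonicGap_of_eq_coe {v : ℂ → EReal} {z : ℂ} {t : ℝ} (ht : v z = t) (B : ℝ) :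
    superharmonicGap v B z = ENNReal.ofReal (B - t) := by
  rw [superharmonicGap, ht, ← EReal.coe_sub, EReal.toENNReal_of_ne_top (EReal.coe_ne_top _),
    EReal.toReal_coe]

lemma toReal_superharmonicGap_of_eq_coe {v : ℂ → EReal} {z : ℂ} {t B : ℝ} (ht : v z = t)
    (hB : v z ≤ B) : (superharmonicGap v B z).toReal = B - t := by
  rw [superharmonicGap_of_eq_coe ht, ENNReal.toReal_ofReal]
  rw [ht, EReal.coe_le_coe_iff] at hB
  exact sub_nonneg.2 hB

section Splitting

variable {R R₁ R₂ B m c ε₀ ε₁ : ℝ} {v : ℂ → EReal} {v₀ v₁ : UnitAddCircle → ℝ}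

lemma ae_sub_toReal_superharmonicGap_eq {f : UnitAddCircle → ℝ} (hR : 1 < R)
    (hB : ∀ z ∈ ball (0 : ℂ) R, v z ≤ (B : EReal))
    (hsplit : ∀ᵐ x, v (expCircle x) = ((f x + c : ℝ) : EReal)) :
    ∀ᵐ x, B - c - (superharmonicGap v B (expCircle x)).toReal = f x := by
  filter_upwards [hsplit] with x hx
  rw [toReal_superharmonicGap_of_eq_coe hx (hB _ (expCircle_mem_ball hR x))]
  ring

lemma lintegral_exp_abs_add_le (hR₂ : 1 < R₂) (hR₁ : R₂ < R₁) (hR : R₁ < R)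
    (hv : IsSubharmonicOn v (ball 0 R)) (hB : ∀ z ∈ ball (0 : ℂ) R, v z ≤ (B : EReal))
    (hm : v 0 = (m : EReal)) (hv₁_int : Integrable v₁)
    (hsplit : ∀ᵐ x, v (expCircle x) = ((v₁ x + v₀ x + c : ℝ) : EReal))
    (hv₁ : ∫ x, |v₁ x| ≤ ε₁) (hv₀ : ∀ᵐ x, |v₀ x| ≤ ε₀) (hε₁0 : 0 < ε₁) (hε₀ : 0 < ε₀)
    (hε₁ : 289 * ε₁ ≤ constB3 R R₁ R₂ ^ 2 * (B - m)) :
    ∫⁻ x, ENNReal.ofReal (exp (π / 4 * (delta0 R R₁ R₂ B m ε₀ ε₁)⁻¹ * |v₁ x + v₀ x|)) ≤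
      ENNReal.ofReal (2 * √2 * exp (π / 4 * (17 / 144))) := by
  obtain ⟨κ, hκ⟩ : ∃ κ, constB3 R R₁ R₂ ^ 2 * (B - m) = 10 * κ :=
    ⟨constB3 R R₁ R₂ ^ 2 * (B - m) / 10, by ring⟩
  have hκ0 : 0 < κ := by linarith
  obtain ⟨δ, hδ, rfl⟩ : ∃ δ > 0, ε₁ = κ * δ ^ 2 := by
    refine ⟨√(ε₁ / κ), sqrt_pos.2 (by positivity), ?_⟩
    rw [sq_sqrt (by positivity), mul_div_cancel₀ _ hκ0.ne']
  have hδ_sq : 289 * δ ^ 2 ≤ 10 := by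
    rw [hκ] at hε₁
    exact le_of_mul_le_mul_right (by linarith) hκ0
  have hboundary := ae_sub_toReal_superharmonicGap_eq (by linarith) hB hsplit
  have hgap0 : (superharmonicGap v B 0).toReal = B - m :=
    toReal_superharmonicGap_of_eq_coe hm (hB 0 (mem_ball_self (by linarith)))
  have hBm : 0 ≤ B - m := hgap0 ▸ ENNReal.toReal_nonneg
  obtain ⟨ρ, hρ, hρR, hρκ⟩ := exists_radius_le_constB3_sq hR₂ hR₁ hR
  rw [delta0_mul_sq hκ0.le hδ.le hκ]
  calc _ = ∫⁻ x, ENNReal.ofReal (exp (π / 4 * (9 / 2 * ε₀ + 2 * (√10 * (κ * δ)))⁻¹ *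
        |B - c - (superharmonicGap v B (expCircle x)).toReal|)) :=
        lintegral_congr_ae (by filter_upwards [hboundary] with x hx; rw [hx])
    _ ≤ _ := by
      refine (isNonnegSuperharmonicOn_superharmonicGap hv hB).lintegral_exp_abs_sub_le_of_scale
        hρ hρR (superharmonicGap_of_eq_coe hm B ▸ ENNReal.ofReal_ne_top) hv₁_int.abs
        (fun x => abs_nonneg _) ?_ hv₁ hε₀ ?_ hδ hδ_sq
      · filter_upwards [hboundary, hv₀] with x hx hx₀
        rw [hx]
        exact (abs_add_le _ _).trans (by gcongr)
      · rw [hgap0]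
        calc π * ((ρ + 1) / (ρ - 1) * (B - m) / log ρ)
            = π * ((ρ + 1) / (ρ - 1) / log ρ) * (B - m) := by ring
          _ ≤ constB3 R R₁ R₂ ^ 2 / 10 * (B - m) := by gcongr
          _ = κ := by linarith

end Splitting

section Distribution

variable {α : Type*} [MeasurableSpace α] {μ : Measure α} {f : α → ℝ} {ε : ℝ}

lemma integral_abs_le_of_eLpNorm_one_lt (hf : Integrable f μ)
    (hlt : eLpNorm f 1 μ < ENNReal.ofReal ε) : ∫ x, |f x| ∂μ ≤ ε := by
  rw [eLpNorm_one_eq_lintegral_enorm, ← ofReal_integral_norm_eq_lintegral_enorm hf] at hlt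
  exact ((ENNReal.ofReal_lt_ofReal_iff_of_nonneg (integral_nonneg fun _ => norm_nonneg _)).1
    hlt).le

lemma ae_abs_le_of_eLpNorm_top_lt (hlt : eLpNorm f ⊤ μ < ENNReal.ofReal ε) :
    ∀ᵐ x ∂μ, |f x| ≤ ε := by
  rw [eLpNorm_exponent_top] at hlt
  filter_upwards [ae_le_eLpNormEssSup (f := f) (μ := μ)] with x hx
  have hle := hx.trans_lt hlt
  rw [← ofReal_norm, ENNReal.ofReal_lt_ofReal_iff_of_nonneg (norm_nonneg _)] at hle
  exact hle.le

lemma exp_coe_mul_abs_coe (a t : ℝ) :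
    EReal.exp ((a : EReal) * ((t : EReal).abs : EReal)) = ENNReal.ofReal (exp (a * |t|)) := by
  rw [EReal.abs_def, EReal.coe_ennreal_ofReal, max_eq_left (abs_nonneg _), ← EReal.coe_mul,
    EReal.exp_coe]

lemma measure_lt_abs_le_of_lintegral_exp_le (hf : AEMeasurable f μ) {a C : ℝ} (ha : 0 ≤ a)
    (hC : ∫⁻ x, ENNReal.ofReal (exp (a * |f x|)) ∂μ ≤ ENNReal.ofReal C) (t : ℝ) :
    μ {x | t < |f x|} ≤ ENNReal.ofReal (C * exp (-(a * t))) := by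
  calc μ {x | t < |f x|}
      ≤ μ {x | ENNReal.ofReal (exp (a * t)) ≤ ENNReal.ofReal (exp (a * |f x|))} := by
        refine measure_mono fun x (hx : t < |f x|) => ?_
        change ENNReal.ofReal _ ≤ ENNReal.ofReal _
        gcongr
    _ ≤ (∫⁻ x, ENNReal.ofReal (exp (a * |f x|)) ∂μ) / ENNReal.ofReal (exp (a * t)) :=
        meas_ge_le_lintegral_div (by fun_prop) (ENNReal.ofReal_pos.2 (exp_pos _)).ne'
          ENNReal.ofReal_ne_top
    _ ≤ ENNReal.ofReal C / ENNReal.ofReal (exp (a * t)) := by gcongr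
    _ = ENNReal.ofReal (C * exp (-(a * t))) := by
        rw [← ENNReal.ofReal_div_of_pos (exp_pos _), exp_neg, div_eq_mul_inv]

variable {g : α → EReal}

lemma lintegral_exp_mul_abs_of_ae_eq_coe (hg : ∀ᵐ x ∂μ, g x = f x) (a : ℝ) :
    ∫⁻ x, EReal.exp ((a : EReal) * ((g x).abs : EReal)) ∂μ =
      ∫⁻ x, ENNReal.ofReal (exp (a * |f x|)) ∂μ := by
  refine lintegral_congr_ae ?_
  filter_upwards [hg] with x hx
  rw [hx, exp_coe_mul_abs_coe]

lemma measure_lt_abs_of_ae_eq_coe (hg : ∀ᵐ x ∂μ, g x = f x) {t : ℝ} (ht : 0 ≤ t) :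
    μ {x | ENNReal.ofReal t < (g x).abs} = μ {x | t < |f x|} := by
  refine measure_congr ?_
  filter_upwards [hg] with x hx
  change (ENNReal.ofReal t < (g x).abs) = (t < |f x|)
  rw [hx, EReal.abs_def, ENNReal.ofReal_lt_ofReal_iff_of_nonneg ht]

end Distribution

end SubharmonicSplitting

open SubharmonicSplitting

theorem mainTheorem6 (R R₁ R₂ B m c ε₀ ε₁ : ℝ)
    (hR₂ : 1 < R₂) (hR₁ : R₂ < R₁) (hR : R₁ < R)
    (v : ℂ → EReal) (hv : IsSubharmonicOn v (Metric.ball 0 R))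
    (hB : ∀ z ∈ Metric.ball (0 : ℂ) R, v z ≤ (B : EReal)) (hm : v 0 = (m : EReal))
    (v₀ v₁ : UnitAddCircle → ℝ)
    (hmem₁ : MemLp v₁ 1 volume) (hmem₀ : MemLp v₀ ⊤ volume)
    (hsplit : ∀ᵐ x : UnitAddCircle, v (expCircle x) = ((v₁ x + v₀ x + c : ℝ) : EReal))
    (hv₁ : eLpNorm v₁ 1 volume < ENNReal.ofReal ε₁)
    (hv₀ : eLpNorm v₀ ⊤ volume < ENNReal.ofReal ε₀)
    (hε₁ : 289 * ε₁ ≤ constB3 R R₁ R₂ ^ 2 * (B - m)) :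
    (∫⁻ x : UnitAddCircle,
        EReal.exp (((Real.pi / 4 * (delta0 R R₁ R₂ B m ε₀ ε₁)⁻¹ : ℝ) : EReal) *
          ((v (expCircle x) - (c : EReal)).abs : EReal))
      ≤ ENNReal.ofReal (constC0 R R₁ R₂)) ∧
    (∀ ε₂ : ℝ, 0 < ε₂ →
      volume {x : UnitAddCircle | ENNReal.ofReal ε₂ < (v (expCircle x) - (c : EReal)).abs}
        ≤ ENNReal.ofReal (2 * √2 *
            Real.exp (Real.pi / 4 *
              (17 / 144 + constB1 R R₁ R₂ / (16 * constB3 R R₁ R₂ ^ 2)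
                - ε₂ * (delta0 R R₁ R₂ B m ε₀ ε₁)⁻¹)))) := by
  have hε₀ : 0 < ε₀ := ENNReal.ofReal_pos.1 (pos_of_gt hv₀)
  have hε₁0 : 0 < ε₁ := ENNReal.ofReal_pos.1 (pos_of_gt hv₁)
  have hint₁ : Integrable v₁ := memLp_one_iff_integrable.1 hmem₁
  have hsub : ∀ᵐ x, v (expCircle x) - (c : EReal) = ((v₁ x + v₀ x : ℝ) : EReal) := by
    filter_upwards [hsplit] with x hx
    rw [hx, ← EReal.coe_sub, add_sub_cancel_right]
  have hexp := lintegral_exp_abs_add_le hR₂ hR₁ hR hv hB hm hint₁ hsplit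
    (integral_abs_le_of_eLpNorm_one_lt hint₁ hv₁) (ae_abs_le_of_eLpNorm_top_lt hv₀) hε₁0 hε₀ hε₁
  have hratio : 0 ≤ constB1 R R₁ R₂ / (16 * constB3 R R₁ R₂ ^ 2) :=
    div_nonneg (constB1_nonneg hR₂ hR₁ hR) (by positivity)
  refine ⟨?_, fun ε₂ hε₂ => ?_⟩
  · rw [lintegral_exp_mul_abs_of_ae_eq_coe hsub, constC0]
    refine hexp.trans (ENNReal.ofReal_le_ofReal ?_)
    gcongr <;> linarith [Real.pi_pos]
  · rw [measure_lt_abs_of_ae_eq_coe hsub hε₂.le]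
    have hd := delta0_pos (R := R) (R₁ := R₁) (R₂ := R₂) (B := B) (m := m) (ε₁ := ε₁) hε₀
    refine (measure_lt_abs_le_of_lintegral_exp_le
      (hint₁.aemeasurable.add hmem₀.aestronglyMeasurable.aemeasurable) (by positivity) hexp
      ε₂).trans (ENNReal.ofReal_le_ofReal ?_)
    rw [mul_assoc, ← Real.exp_add]
    gcongr
    linarith [mul_nonneg Real.pi_pos.le hratio]
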